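/- Let $H$ and $K$ be separable complex Hilbert spaces. For $1\le r<\infty$ let $S_r(H)$ denote the Schatten space of all compact operators $A$ on $H$ with $\sum_i s_i(A)^r<\infty$, where $(s_i(A))$ is the sequence of singular values of $A$ (the eigenvalues of $|A|=(A^*A)^{1/2}$, counted with multiplicity), equipped with the norm $\|A\|_r=\big(\sum_i s_i(A)^r\big)^{1/r}$; define $S_r(K)$ in the same way. Let $1\le q<p<\infty$. Call a bounded linear operator $T:S_p(H)\to S_q(K)$ positive if $T(A)\ge 0$ for every $A\in S_p(H)$ with $A\ge 0$. Then every positive bounded linear operator $T:S_p(H)\to S_q(K)$ is compact. -/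

import Mathlib

open scoped ENNReal InnerProductSpace

namespace Schatten

noncomputable section

variable {H : Type*} [NormedAddCommGroup H] [InnerProductSpace ℂ H] [CompleteSpace H]

/-- The multiplicity of `σ > 0` as a singular value of `A`, i.e. as an eigenvalue of
`|A| = (A* A)^(1/2)`: the dimension of the eigenspace of `A* A` at `σ ^ 2`.
It is `0` if `σ` is not a singular value of `A`, and it is finite when `A` is compact. -/
def singularMultiplicity (A : H →L[ℂ] H) (σ : ℝ) : ℕ :=
  Module.finrank ℂ
    (Module.End.eigenspace ((ContinuousLinearMap.adjoint A ∘L A : H →L[ℂ] H) : H →ₗ[ℂ] H)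
      ((σ : ℂ) ^ 2))

/-- The sum `∑ i, s_i(A) ^ p` over the nonzero singular values of the compact operator `A`,
each repeated according to its multiplicity; this is the trace of `|A| ^ p`. -/
def singularSum (p : ℝ) (A : H →L[ℂ] H) : ℝ≥0∞ :=
  ∑' σ : Set.Ioi (0 : ℝ), (singularMultiplicity A σ : ℝ≥0∞) * ENNReal.ofReal ((σ : ℝ) ^ p)

/-- Singular value decomposition of a compact operator. -/
theorem exists_svd (A : H →L[ℂ] H) (hA : IsCompactOperator A) :
    ∃ (ι : Type) (s : ι → ℝ) (u v : ι → H), (∀ i, 0 < s i) ∧ Orthonormal ℂ u ∧ Orthonormal ℂ v ∧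
      (∀ i, A (u i) = (s i : ℂ) • v i) ∧ (∀ x, (∀ i, ⟪u i, x⟫_ℂ = 0) → A x = 0) ∧
      ∀ p : ℝ, singularSum p A = ∑' i, ENNReal.ofReal (s i ^ p) := by
  classical
  set T : H →L[ℂ] H := ContinuousLinearMap.adjoint A ∘L A with hT
  have hTc : IsCompactOperator T := hA.clm_comp (ContinuousLinearMap.adjoint A)
  have hTs : (T : H →ₗ[ℂ] H).IsSymmetric := by
    intro x y
    simp [hT, ContinuousLinearMap.adjoint_inner_left, ContinuousLinearMap.adjoint_inner_right]
  have hTin : ∀ x y, ⟪A x, A y⟫_ℂ = ⟪x, T y⟫_ℂ := by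
    intro x y
    simp [hT, ContinuousLinearMap.adjoint_inner_right]
  have hfin : ∀ σ : Set.Ioi (0 : ℝ), FiniteDimensional ℂ
      (Module.End.eigenspace (T : H →ₗ[ℂ] H) (((σ : ℝ) : ℂ) ^ 2)) := fun σ =>
    ContinuousLinearMap.finite_dimensional_eigenspace hTc _
      (pow_ne_zero _ (by exact_mod_cast (ne_of_gt σ.2)))
  let E : Set.Ioi (0 : ℝ) → Submodule ℂ H := fun σ =>
    Module.End.eigenspace (T : H →ₗ[ℂ] H) (((σ : ℝ) : ℂ) ^ 2)
  have hinj : Function.Injective (fun σ : Set.Ioi (0 : ℝ) => ((σ : ℝ) : ℂ) ^ 2) := by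
    rintro ⟨a, ha⟩ ⟨b, hb⟩ h
    have h' : a ^ 2 = b ^ 2 := by
      have : ((a : ℂ)) ^ 2 = (b : ℂ) ^ 2 := h
      exact_mod_cast this
    have ha' : (0 : ℝ) < a := ha
    have hb' : (0 : ℝ) < b := hb
    exact Subtype.ext ((pow_left_inj₀ ha'.le hb'.le two_ne_zero).1 h')
  have hE : OrthogonalFamily ℂ (fun σ => E σ) fun σ => (E σ).subtypeₗᵢ :=
    hTs.orthogonalFamily_eigenspaces.comp hinj
  let bas : ∀ σ : Set.Ioi (0 : ℝ), OrthonormalBasis (Fin (Module.finrank ℂ (E σ))) ℂ (E σ) :=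
    fun σ => haveI := hfin σ; stdOrthonormalBasis ℂ (E σ)
  let u : (Σ σ : Set.Ioi (0 : ℝ), Fin (Module.finrank ℂ (E σ))) → H :=
    fun i => ((bas i.1 i.2 : E i.1) : H)
  let s : (Σ σ : Set.Ioi (0 : ℝ), Fin (Module.finrank ℂ (E σ))) → ℝ := fun i => (i.1 : ℝ)
  have hs : ∀ i, 0 < s i := fun i => i.1.2
  have hsc : ∀ i, (s i : ℂ) ≠ 0 := fun i => by exact_mod_cast (hs i).ne'
  have hu : Orthonormal ℂ u := hE.orthonormal_sigma_orthonormal fun σ => (bas σ).orthonormal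
  have hTu : ∀ i, T (u i) = ((s i : ℂ) ^ 2) • u i := fun i =>
    Module.End.mem_eigenspace_iff.1 (bas i.1 i.2).2
  refine ⟨_, s, u, fun i => (s i : ℂ)⁻¹ • A (u i), hs, hu, ?_, ?_, ?_, ?_⟩
  · rw [orthonormal_iff_ite] at hu ⊢
    intro i j
    rw [inner_smul_left, inner_smul_right, hTin, hTu, inner_smul_right, hu]
    split_ifs with h
    · subst h
      have := hsc i
      simp only [map_inv₀, Complex.conj_ofReal]
      field_simp
    · simp
  · intro i
    rw [smul_smul, mul_inv_cancel₀ (hsc i), one_smul]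
  · intro x hx
    have hxE : ∀ σ : Set.Ioi (0 : ℝ), ∀ y ∈ E σ, ⟪y, x⟫_ℂ = 0 := by
      intro σ y hy
      have := (bas σ).sum_repr ⟨y, hy⟩
      have h2 : y = ∑ i, ((bas σ).repr ⟨y, hy⟩ i) • ((bas σ i : E σ) : H) := by
        have := congrArg (Subtype.val) this
        simpa using this.symm
      rw [h2, sum_inner]
      refine Finset.sum_eq_zero fun i _ => ?_
      rw [inner_smul_left, hx ⟨σ, i⟩, mul_zero]
    have hTx : T x = 0 := by
      have : T x ∈ (⨆ μ, Module.End.eigenspace (T : H →ₗ[ℂ] H) μ)ᗮ := by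
        rw [← Submodule.iInf_orthogonal, Submodule.mem_iInf]
        intro μ
        rw [Submodule.mem_orthogonal]
        intro y hy
        have hy' : T y = μ • y := Module.End.mem_eigenspace_iff.1 hy
        have e1 : ⟪y, T x⟫_ℂ = (starRingEnd ℂ) μ * ⟪y, x⟫_ℂ := by
          rw [← inner_smul_left, ← hy']
          exact (hTs y x).symm
        rw [e1]
        by_cases hy0 : y = 0
        · simp [hy0]
        by_cases hμ : μ = 0
        · simp [hμ]
        have e2 : μ * ⟪y, y⟫_ℂ = ⟪A y, A y⟫_ℂ := by
          rw [hTin, hy', inner_smul_right]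
        have e3 : μ = ((‖A y‖ ^ 2 / ‖y‖ ^ 2 : ℝ) : ℂ) := by
          rw [inner_self_eq_norm_sq_to_K, inner_self_eq_norm_sq_to_K] at e2
          have hn : ((‖y‖ : ℝ) : ℂ) ^ 2 ≠ 0 := by
            exact_mod_cast pow_ne_zero 2 (norm_ne_zero_iff.2 hy0)
          push_cast
          rw [eq_div_iff hn]
          exact e2
        have e4 : (0 : ℝ) < ‖A y‖ / ‖y‖ := by
          rcases (div_nonneg (norm_nonneg (A y)) (norm_nonneg y)).eq_or_lt with h | h
          · exfalso
            apply hμ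
            rw [e3, ← div_pow, ← h]
            simp
          · exact h
        have e5 : μ = (((⟨‖A y‖ / ‖y‖, e4⟩ : Set.Ioi (0 : ℝ)) : ℝ) : ℂ) ^ 2 := by
          rw [e3]
          push_cast
          rw [div_pow]
        rw [hxE ⟨‖A y‖ / ‖y‖, e4⟩ y (by rw [e5] at hy; exact hy), mul_zero]
      rw [ContinuousLinearMap.orthogonalComplement_iSup_eigenspaces_eq_bot hTc hTs] at this
      simpa using this
    rw [← inner_self_eq_zero (𝕜 := ℂ), hTin, hTx, inner_zero_right]
  · intro p
    refine Eq.trans ?_ (ENNReal.tsum_sigma fun (σ : Set.Ioi (0 : ℝ))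
      (_ : Fin (Module.finrank ℂ (E σ))) => ENNReal.ofReal ((σ : ℝ) ^ p)).symm
    refine tsum_congr fun σ => ?_
    rw [tsum_fintype, Finset.sum_const, Finset.card_univ, Fintype.card_fin, nsmul_eq_mul]
    rfl

/-- The expansion of `⟪f, A e⟫` along a singular value decomposition. -/
theorem hasSum_svd {ι : Type*} {A : H →L[ℂ] H} {s : ι → ℝ} {u v : ι → H}
    (hu : Orthonormal ℂ u) (hA : ∀ i, A (u i) = (s i : ℂ) • v i)
    (h0 : ∀ x, (∀ i, ⟪u i, x⟫_ℂ = 0) → A x = 0) (f e : H) :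
    HasSum (fun i => ⟪u i, e⟫_ℂ * ((s i : ℂ) * ⟪f, v i⟫_ℂ)) ⟪f, A e⟫_ℂ := by
  obtain ⟨w, b, hw, hb⟩ := hu.toSubtypeRange.exists_hilbertBasis_extension
  have h1 : HasSum (fun i : w => ⟪f, A (b.repr e i • b i)⟫_ℂ) ⟪f, A e⟫_ℂ :=
    ((b.hasSum_repr e).mapL A).mapL (innerSL ℂ f)
  have hinj : Function.Injective (fun i : ι => (⟨u i, hw ⟨i, rfl⟩⟩ : w)) := fun i j h =>
    hu.linearIndependent.injective (congrArg Subtype.val h)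
  rw [← hinj.hasSum_iff] at h1
  · convert h1 using 2 with i
    simp only [Function.comp_apply, map_smul, b.repr_apply_apply, hb, hA, inner_smul_right]
  · intro x hx
    have : A (b x) = 0 := by
      apply h0
      intro i
      have hne : (⟨u i, hw ⟨i, rfl⟩⟩ : w) ≠ x := fun h => hx ⟨i, h⟩
      have := b.orthonormal.2 hne
      simpa [hb] using this
    simp [this]

/-- `ℓ_p`-summability of matrix entries along orthonormal families. -/
theorem tsum_inner_le_singularSum {p : ℝ} (hp : 1 ≤ p) {A : H →L[ℂ] H} (hA : IsCompactOperator A)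
    {κ : Type*} {e f : κ → H} (he : Orthonormal ℂ e) (hf : Orthonormal ℂ f) :
    ∑' k, ‖⟪f k, A (e k)⟫_ℂ‖ₑ ^ p ≤ singularSum p A := by
  obtain ⟨ι, s, u, v, hs, hu, hv, hAu, h0, hS⟩ := exists_svd A hA
  have hp0 : 0 < p := by linarith
  let d : κ → ι → ℝ≥0∞ := fun k i => ‖⟪u i, e k⟫_ℂ‖ₑ * ‖⟪f k, v i⟫_ℂ‖ₑ
  have hd : ∀ k i, d k i ≤ ENNReal.ofReal ((‖⟪u i, e k⟫_ℂ‖ ^ 2 + ‖⟪f k, v i⟫_ℂ‖ ^ 2) / 2) := by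
    intro k i
    simp only [d, ← ofReal_norm]
    rw [← ENNReal.ofReal_mul (norm_nonneg _)]
    apply ENNReal.ofReal_le_ofReal
    nlinarith [sq_nonneg (‖⟪u i, e k⟫_ℂ‖ - ‖⟪f k, v i⟫_ℂ‖)]
  have hd1 : ∀ k (t : Finset ι), ∑ i ∈ t, d k i ≤ 1 := by
    intro k t
    refine (Finset.sum_le_sum fun i _ => hd k i).trans ?_
    rw [← ENNReal.ofReal_sum_of_nonneg (fun i _ => by positivity), ← ENNReal.ofReal_one]
    apply ENNReal.ofReal_le_ofReal
    rw [← Finset.sum_div, Finset.sum_add_distrib]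
    have b1 := hu.sum_inner_products_le (e k) (s := t)
    have b2 := hv.sum_inner_products_le (f k) (s := t)
    rw [he.1 k] at b1
    rw [hf.1 k] at b2
    simp only [norm_inner_symm (f k)]
    linarith
  have hd2 : ∀ i (t : Finset κ), ∑ k ∈ t, d k i ≤ 1 := by
    intro i t
    refine (Finset.sum_le_sum fun k _ => hd k i).trans ?_
    rw [← ENNReal.ofReal_sum_of_nonneg (fun i _ => by positivity), ← ENNReal.ofReal_one]
    apply ENNReal.ofReal_le_ofReal
    rw [← Finset.sum_div, Finset.sum_add_distrib]
    have b1 := he.sum_inner_products_le (u i) (s := t)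
    have b2 := hf.sum_inner_products_le (v i) (s := t)
    rw [hu.1 i] at b1
    rw [hv.1 i] at b2
    simp only [norm_inner_symm (u i)]
    linarith
  have hse : ∀ i, ‖(s i : ℂ)‖ₑ = ENNReal.ofReal (s i) := by
    intro i
    rw [← ofReal_norm, Complex.norm_real, Real.norm_of_nonneg (hs i).le]
  have key : ∀ k, ‖⟪f k, A (e k)⟫_ℂ‖ₑ ^ p ≤ ∑' i, d k i * ENNReal.ofReal (s i) ^ p := by
    intro k
    have h1 := hasSum_svd hu hAu h0 (f k) (e k)
    have h2 : ∀ t : Finset ι, ‖∑ i ∈ t, ⟪u i, e k⟫_ℂ * ((s i : ℂ) * ⟪f k, v i⟫_ℂ)‖ₑ ^ p ≤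
        ∑' i, d k i * ENNReal.ofReal (s i) ^ p := by
      intro t
      have h3 : ‖∑ i ∈ t, ⟪u i, e k⟫_ℂ * ((s i : ℂ) * ⟪f k, v i⟫_ℂ)‖ₑ ≤
          ∑ i ∈ t, d k i * ENNReal.ofReal (s i) := by
        refine (enorm_sum_le _ _).trans (Finset.sum_le_sum fun i _ => ?_)
        simp only [d, enorm_mul, hse]
        apply le_of_eq
        ring
      have h4 := ENNReal.inner_le_weight_mul_Lp_of_nonneg t hp (d k)
        (fun i => ENNReal.ofReal (s i))
      have h5 : (∑ i ∈ t, d k i) ^ (1 - p⁻¹) ≤ 1 :=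
        ENNReal.rpow_le_one (hd1 k t) (sub_nonneg.2 (inv_le_one_of_one_le₀ hp))
      have h6 := (h3.trans h4).trans (mul_le_mul_left h5 _)
      rw [one_mul] at h6
      refine (ENNReal.rpow_le_rpow h6 hp0.le).trans ?_
      rw [← ENNReal.rpow_mul, inv_mul_cancel₀ hp0.ne', ENNReal.rpow_one]
      exact ENNReal.sum_le_tsum t
    have h7 : Filter.Tendsto
        (fun t : Finset ι => ‖∑ i ∈ t, ⟪u i, e k⟫_ℂ * ((s i : ℂ) * ⟪f k, v i⟫_ℂ)‖ₑ ^ p)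
        Filter.atTop (nhds (‖⟪f k, A (e k)⟫_ℂ‖ₑ ^ p)) :=
      ((ENNReal.continuous_rpow_const (y := p)).comp continuous_enorm).tendsto _ |>.comp h1
    exact le_of_tendsto' h7 h2
  calc ∑' k, ‖⟪f k, A (e k)⟫_ℂ‖ₑ ^ p
      ≤ ∑' k, ∑' i, d k i * ENNReal.ofReal (s i) ^ p := ENNReal.tsum_le_tsum key
    _ = ∑' i, ∑' k, d k i * ENNReal.ofReal (s i) ^ p := ENNReal.tsum_comm
    _ ≤ ∑' i, ENNReal.ofReal (s i ^ p) := by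
        refine ENNReal.tsum_le_tsum fun i => ?_
        rw [ENNReal.tsum_mul_right, ENNReal.ofReal_rpow_of_pos (hs i)]
        refine mul_le_of_le_one_left zero_le ?_
        rw [ENNReal.tsum_eq_iSup_sum]
        exact iSup_le (hd2 i)
    _ = singularSum p A := (hS p).symm

/-- The supremum of the previous inequality is attained. -/
theorem exists_singularSum_eq (A : H →L[ℂ] H) (hA : IsCompactOperator A) :
    ∃ (ι : Type) (e f : ι → H), Orthonormal ℂ e ∧ Orthonormal ℂ f ∧
      (∀ p : ℝ, singularSum p A = ∑' i, ‖⟪f i, A (e i)⟫_ℂ‖ₑ ^ p) ∧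
      ∀ p : ℝ, singularSum p A = 0 → A = 0 := by
  obtain ⟨ι, s, u, v, hs, hu, hv, hAu, h0, hS⟩ := exists_svd A hA
  refine ⟨ι, u, v, hu, hv, fun p => ?_, fun p h => ?_⟩
  · rw [hS]
    refine tsum_congr fun i => ?_
    rw [hAu, inner_smul_right, inner_self_eq_norm_sq_to_K, hv.1 i, ← ofReal_norm]
    simp [abs_of_pos (hs i), ENNReal.ofReal_rpow_of_pos (hs i)]
  · rw [hS, ENNReal.tsum_eq_zero] at h
    ext x
    refine h0 x fun i => absurd (h i) ?_
    simpa using Real.rpow_pos_of_pos (hs i) p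

theorem singularSum_add_le {p : ℝ} (hp : 1 ≤ p) {A B : H →L[ℂ] H} (hA : IsCompactOperator A)
    (hB : IsCompactOperator B) :
    singularSum p (A + B) ^ (1 / p) ≤ singularSum p A ^ (1 / p) + singularSum p B ^ (1 / p) := by
  have hp0 : 0 < p := by linarith
  have hq : 0 ≤ 1 / p := by positivity
  obtain ⟨ι, e, f, he, hf, hS, -⟩ := exists_singularSum_eq (A + B) (hA.add hB)
  have hfin : ∀ t : Finset ι, (∑ i ∈ t, ‖⟪f i, (A + B) (e i)⟫_ℂ‖ₑ ^ p) ≤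
      (singularSum p A ^ (1 / p) + singularSum p B ^ (1 / p)) ^ p := by
    intro t
    have h1 : (∑ i ∈ t, ‖⟪f i, (A + B) (e i)⟫_ℂ‖ₑ ^ p) ^ (1 / p) ≤
        singularSum p A ^ (1 / p) + singularSum p B ^ (1 / p) := by
      calc (∑ i ∈ t, ‖⟪f i, (A + B) (e i)⟫_ℂ‖ₑ ^ p) ^ (1 / p)
          ≤ (∑ i ∈ t, (‖⟪f i, A (e i)⟫_ℂ‖ₑ + ‖⟪f i, B (e i)⟫_ℂ‖ₑ) ^ p) ^ (1 / p) := by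
            refine ENNReal.rpow_le_rpow (Finset.sum_le_sum fun i _ => ?_) hq
            refine ENNReal.rpow_le_rpow ?_ hp0.le
            rw [add_apply, inner_add_right]
            exact enorm_add_le _ _
        _ ≤ _ := ENNReal.Lp_add_le t _ _ hp
        _ ≤ _ := add_le_add
            (ENNReal.rpow_le_rpow ((ENNReal.sum_le_tsum t).trans
              (tsum_inner_le_singularSum hp hA he hf)) hq)
            (ENNReal.rpow_le_rpow ((ENNReal.sum_le_tsum t).trans
              (tsum_inner_le_singularSum hp hB he hf)) hq)
    have h2 := ENNReal.rpow_le_rpow h1 hp0.le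
    rwa [← ENNReal.rpow_mul, one_div_mul_cancel hp0.ne', ENNReal.rpow_one] at h2
  rw [hS, ENNReal.tsum_eq_iSup_sum]
  have h3 := ENNReal.rpow_le_rpow (iSup_le hfin) hq
  rwa [← ENNReal.rpow_mul, mul_one_div_cancel hp0.ne', ENNReal.rpow_one] at h3

theorem singularSum_smul_le {p : ℝ} (hp : 1 ≤ p) (c : ℂ) {A : H →L[ℂ] H}
    (hA : IsCompactOperator A) : singularSum p (c • A) ≤ ‖c‖ₑ ^ p * singularSum p A := by
  obtain ⟨ι, e, f, he, hf, hS, -⟩ := exists_singularSum_eq (c • A) (hA.smul c)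
  rw [hS]
  calc ∑' i, ‖⟪f i, (c • A) (e i)⟫_ℂ‖ₑ ^ p = ‖c‖ₑ ^ p * ∑' i, ‖⟪f i, A (e i)⟫_ℂ‖ₑ ^ p := by
        rw [← ENNReal.tsum_mul_left]
        refine tsum_congr fun i => ?_
        rw [smul_apply, inner_smul_right, enorm_mul,
          ENNReal.mul_rpow_of_nonneg _ _ (by linarith)]
    _ ≤ _ := mul_le_mul_right (tsum_inner_le_singularSum hp hA he hf) _

theorem singularSum_zero (p : ℝ) (hp : 1 ≤ p) : singularSum p (0 : H →L[ℂ] H) = 0 := by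
  have h := singularSum_smul_le (H := H) hp 0 (A := 0) isCompactOperator_zero
  simpa [ENNReal.zero_rpow_of_pos (show 0 < p by linarith)] using h

theorem singularSum_smul {p : ℝ} (hp : 1 ≤ p) (c : ℂ) {A : H →L[ℂ] H}
    (hA : IsCompactOperator A) : singularSum p (c • A) = ‖c‖ₑ ^ p * singularSum p A := by
  have hp0 : 0 < p := by linarith
  rcases eq_or_ne c 0 with rfl | hc
  · simp [singularSum_zero p hp, ENNReal.zero_rpow_of_pos hp0]
  refine le_antisymm (singularSum_smul_le hp c hA) ?_
  have h := singularSum_smul_le hp c⁻¹ (A := c • A) (hA.smul c)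
  rw [smul_smul, inv_mul_cancel₀ hc, one_smul] at h
  calc ‖c‖ₑ ^ p * singularSum p A ≤ ‖c‖ₑ ^ p * (‖c⁻¹‖ₑ ^ p * singularSum p (c • A)) :=
        mul_le_mul_right h _
    _ = singularSum p (c • A) := by
        rw [← mul_assoc, ← ENNReal.mul_rpow_of_nonneg _ _ hp0.le, ← enorm_mul, mul_inv_cancel₀ hc]
        simp

end

end Schatten

noncomputable section

open Schatten

/-- The Schatten class as a linear subspace of the bounded operators on `H`: the compact operators
`A` with `∑ i, s_i(A) ^ p < ∞`. -/
def schattenSubmodule (p : ℝ) [hp : Fact (1 ≤ p)] (H : Type*) [NormedAddCommGroup H]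
    [InnerProductSpace ℂ H] [CompleteSpace H] : Submodule ℂ (H →L[ℂ] H) where
  carrier := {A | IsCompactOperator A ∧ singularSum p A < ∞}
  zero_mem' := ⟨isCompactOperator_zero, by simp [singularSum_zero p hp.out]⟩
  add_mem' := by
    rintro A B ⟨hA, hA'⟩ ⟨hB, hB'⟩
    have hp0 : 0 < p := lt_of_lt_of_le one_pos hp.out
    refine ⟨hA.add hB, ?_⟩
    rw [← ENNReal.rpow_lt_top_iff_of_pos (show 0 < 1 / p by positivity)] at hA' hB' ⊢
    exact (singularSum_add_le hp.out hA hB).trans_lt (ENNReal.add_lt_top.2 ⟨hA', hB'⟩)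
  smul_mem' := by
    rintro c A ⟨hA, hA'⟩
    have hp0 : 0 < p := lt_of_lt_of_le one_pos hp.out
    refine ⟨hA.smul c, ?_⟩
    rw [singularSum_smul hp.out c hA]
    exact ENNReal.mul_lt_top (ENNReal.rpow_lt_top_of_nonneg hp0.le enorm_ne_top) hA'

/-- The Schatten space `S_p(H)`. It is a type of its own, so that it carries the Schatten norm and
not the operator norm. -/
def SchattenClass (p : ℝ) [Fact (1 ≤ p)] (H : Type*) [NormedAddCommGroup H]
    [InnerProductSpace ℂ H] [CompleteSpace H] : Type _ :=
  schattenSubmodule p H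

namespace SchattenClass

variable {p : ℝ} [hp : Fact (1 ≤ p)] {H : Type*} [NormedAddCommGroup H] [InnerProductSpace ℂ H]
  [CompleteSpace H]

instance instAddCommGroup : AddCommGroup (SchattenClass p H) :=
  inferInstanceAs (AddCommGroup (schattenSubmodule p H))

instance instModule : Module ℂ (SchattenClass p H) :=
  inferInstanceAs (Module ℂ (schattenSubmodule p H))

/-- The element `A` of `S_p(H)` as a bounded operator on `H`. -/
def toOperator : SchattenClass p H →ₗ[ℂ] (H →L[ℂ] H) := (schattenSubmodule p H).subtype

theorem toOperator_injective : Function.Injective (toOperator : SchattenClass p H → H →L[ℂ] H) :=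
  Subtype.val_injective

theorem isCompactOperator (A : SchattenClass p H) : IsCompactOperator (toOperator A) := A.2.1

theorem singularSum_lt_top (A : SchattenClass p H) : singularSum p (toOperator A) < ∞ := A.2.2

/-- The Schatten norm `‖A‖ = (∑ i, s_i(A) ^ p) ^ (1 / p)`. -/
instance instNorm : Norm (SchattenClass p H) :=
  ⟨fun A => (singularSum p (toOperator A)).toReal ^ (1 / p)⟩

theorem norm_def (A : SchattenClass p H) :
    ‖A‖ = (singularSum p (toOperator A)).toReal ^ (1 / p) := rfl

theorem normedSpaceCore : NormedSpace.Core ℂ (SchattenClass p H) where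
  norm_nonneg A := Real.rpow_nonneg ENNReal.toReal_nonneg _
  norm_smul c A := by
    have hp0 : 0 < p := lt_of_lt_of_le one_pos hp.out
    rw [norm_def, norm_def, map_smul, singularSum_smul hp.out c A.isCompactOperator,
      ENNReal.toReal_mul, ← ENNReal.toReal_rpow, toReal_enorm,
      Real.mul_rpow (by positivity) ENNReal.toReal_nonneg, ← Real.rpow_mul (norm_nonneg c),
      mul_one_div_cancel hp0.ne', Real.rpow_one]
  norm_triangle A B := by
    have hp0 : 0 < p := lt_of_lt_of_le one_pos hp.out
    have hq : 0 ≤ 1 / p := by positivity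
    have h := singularSum_add_le hp.out A.isCompactOperator B.isCompactOperator
    have hA := ENNReal.rpow_lt_top_of_nonneg hq A.singularSum_lt_top.ne
    have hB := ENNReal.rpow_lt_top_of_nonneg hq B.singularSum_lt_top.ne
    have h' := ENNReal.toReal_mono (ENNReal.add_lt_top.2 ⟨hA, hB⟩).ne h
    rw [ENNReal.toReal_add hA.ne hB.ne] at h'
    simpa only [norm_def, map_add, ENNReal.toReal_rpow] using h'
  norm_eq_zero_iff A := by
    have hp0 : 0 < p := lt_of_lt_of_le one_pos hp.out
    have hq : 1 / p ≠ 0 := by positivity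
    rw [norm_def, Real.rpow_eq_zero ENNReal.toReal_nonneg hq, ENNReal.toReal_eq_zero_iff]
    constructor
    · rintro (h | h)
      · obtain ⟨_, _, _, _, _, _, h0⟩ := exists_singularSum_eq _ A.isCompactOperator
        exact toOperator_injective ((h0 p h).trans (map_zero toOperator).symm)
      · exact absurd h A.singularSum_lt_top.ne
    · rintro rfl
      left
      rw [map_zero, singularSum_zero p hp.out]

instance instNormedAddCommGroup : NormedAddCommGroup (SchattenClass p H) :=
  NormedAddCommGroup.ofCore normedSpaceCore

instance instNormedSpace : NormedSpace ℂ (SchattenClass p H) :=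
  NormedSpace.ofCore normedSpaceCore

end SchattenClass

/-- An operator between Schatten spaces is positive if it maps the cone of positive (semidefinite)
operators in `S_p(H)` into the cone of positive operators in `S_q(K)`. -/
def IsPositiveMap {p q : ℝ} [Fact (1 ≤ p)] [Fact (1 ≤ q)]
    {H : Type*} [NormedAddCommGroup H] [InnerProductSpace ℂ H] [CompleteSpace H]
    {K : Type*} [NormedAddCommGroup K] [InnerProductSpace ℂ K] [CompleteSpace K]
    (T : SchattenClass p H →L[ℂ] SchattenClass q K) : Prop :=
  ∀ A : SchattenClass p H, (SchattenClass.toOperator A).IsPositive →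
    (SchattenClass.toOperator (T A)).IsPositive

end

/-! Write `P` for the projection onto a finite-dimensional `V`, and `Q = 1 - P`. The theorem follows
once `A ↦ T (P A P)`, which has finite rank, approximates `T` in norm for suitable `V`.

Given `δ > 0`, some `V` satisfies `‖T A‖ ≤ δ ‖A‖` for all positive `A` vanishing on `V`
(`exists_finiteDimensional_norm_le`). Otherwise, for every `N`, there are `N` positive finite-rank
contractions with mutually orthogonal ranges and images of norm above `δ`. Their sum `S` has `‖S‖ ^
p ≤ N`, while McCarthy's inequality `tr X ^ q + tr Y ^ q ≤ tr (X + Y) ^ q` (`singularSum_add_ge`)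
gives `N δ ^ q ≤ ‖T S‖ ^ q ≤ ‖T‖ ^ q N ^ (q / p)`, which fails for large `N` because `q < p`.

For positive `A` this makes `T (Q A Q)` small. The off-diagonal part is dominated through
positivity: `a² P A P + a⁻² Q A Q ± (P A Q + Q A P) ≥ 0` for `a ≠ 0`, so a small `a` makes its image
small too (`norm_map_sub_compression_sub_compression_le`). A general `A` is a combination of four
positive operators of norm at most `‖A‖`. -/

namespace Schatten

variable {H : Type*} [NormedAddCommGroup H] [InnerProductSpace ℂ H] [CompleteSpace H]

/-! ### Singular sums under contractions and adjoints. -/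

/-- Power means with sub-stochastic weights. -/
theorem tsum_rpow_le_of_weights {κ ι : Type*} {p : ℝ} (hp : 1 ≤ p) (d : κ → ι → ℝ≥0∞)
    (s : ι → ℝ≥0∞) (c : κ → ℝ≥0∞) (hd : ∀ k, ∑' i, d k i ≤ 1)
    (hc : ∀ k, c k ≤ ∑' i, d k i * s i) :
    ∑' k, c k ^ p ≤ ∑' i, (∑' k, d k i) * s i ^ p := by
  have hp0 : 0 < p := by linarith
  have key : ∀ k, c k ^ p ≤ ∑' i, d k i * s i ^ p := by
    intro k
    have h1 : c k ≤ (∑' i, d k i * s i ^ p) ^ p⁻¹ := by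
      refine (hc k).trans ?_
      rw [ENNReal.tsum_eq_iSup_sum]
      refine iSup_le fun t => ?_
      refine (ENNReal.inner_le_weight_mul_Lp_of_nonneg t hp (d k) s).trans ?_
      have h5 : (∑ i ∈ t, d k i) ^ (1 - p⁻¹) ≤ 1 :=
        ENNReal.rpow_le_one ((ENNReal.sum_le_tsum t).trans (hd k))
          (sub_nonneg.2 (inv_le_one_of_one_le₀ hp))
      refine (mul_le_mul_left h5 _).trans ?_
      rw [one_mul]
      exact ENNReal.rpow_le_rpow (ENNReal.sum_le_tsum t) (inv_nonneg.2 hp0.le)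
    refine (ENNReal.rpow_le_rpow h1 hp0.le).trans ?_
    rw [← ENNReal.rpow_mul, inv_mul_cancel₀ hp0.ne', ENNReal.rpow_one]
  refine (ENNReal.tsum_le_tsum key).trans ?_
  rw [ENNReal.tsum_comm]
  simp_rw [ENNReal.tsum_mul_right]
  exact le_rfl

theorem tsum_mul_le_one_of_sq {ι : Type*} {a b : ι → ℝ} (ha0 : ∀ i, 0 ≤ a i) (hb0 : ∀ i, 0 ≤ b i)
    (ha : ∀ t : Finset ι, ∑ i ∈ t, a i ^ 2 ≤ 1) (hb : ∀ t : Finset ι, ∑ i ∈ t, b i ^ 2 ≤ 1) :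
    ∑' i, ENNReal.ofReal (a i) * ENNReal.ofReal (b i) ≤ 1 := by
  rw [ENNReal.tsum_eq_iSup_sum]
  refine iSup_le fun t => ?_
  simp_rw [← ENNReal.ofReal_mul (ha0 _)]
  rw [← ENNReal.ofReal_sum_of_nonneg (fun i _ => mul_nonneg (ha0 i) (hb0 i)), ← ENNReal.ofReal_one]
  apply ENNReal.ofReal_le_ofReal
  have h : ∑ i ∈ t, a i * b i ≤ ∑ i ∈ t, (a i ^ 2 + b i ^ 2) / 2 :=
    Finset.sum_le_sum fun i _ => by nlinarith [sq_nonneg (a i - b i)]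
  rw [← Finset.sum_div, Finset.sum_add_distrib] at h
  linarith [ha t, hb t]

omit [CompleteSpace H] in
theorem sum_norm_inner_sq_le_one {ι : Type*} {u : ι → H} (hu : Orthonormal ℂ u) {x : H}
    (hx : ‖x‖ ≤ 1) (t : Finset ι) : ∑ i ∈ t, ‖⟪u i, x⟫_ℂ‖ ^ 2 ≤ 1 :=
  (hu.sum_inner_products_le x).trans (pow_le_one₀ (norm_nonneg x) hx)

/-- Matrix entries of a two-sided contraction of an operator in terms of its singular values. -/
theorem tsum_inner_contraction_le {p : ℝ} (hp : 1 ≤ p) {ι κ : Type*} {A : H →L[ℂ] H} {s : ι → ℝ}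
    {u v : ι → H} (hs : ∀ i, 0 ≤ s i) (hu : Orthonormal ℂ u) (hv : Orthonormal ℂ v)
    (hA : ∀ i, A (u i) = (s i : ℂ) • v i) (h0 : ∀ x, (∀ i, ⟪u i, x⟫_ℂ = 0) → A x = 0)
    {M N : H →L[ℂ] H} (hM : ‖M‖ ≤ 1) (hN : ‖N‖ ≤ 1) {e f : κ → H} (he : Orthonormal ℂ e)
    (hf : Orthonormal ℂ f) :
    ∑' k, ‖⟪f k, M (A (N (e k)))⟫_ℂ‖ₑ ^ p ≤ ∑' i, ENNReal.ofReal (s i ^ p) := by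
  have hp0 : 0 < p := by linarith
  have le_one : ∀ (L : H →L[ℂ] H), ‖L‖ ≤ 1 → ∀ x : H, ‖x‖ = 1 → ‖L x‖ ≤ 1 := fun L hL x hx => by
    simpa [hx] using L.le_of_opNorm_le hL x
  have hM' : ‖ContinuousLinearMap.adjoint M‖ ≤ 1 := by
    rwa [ContinuousLinearMap.adjoint.norm_map]
  have hN' : ‖ContinuousLinearMap.adjoint N‖ ≤ 1 := by
    rwa [ContinuousLinearMap.adjoint.norm_map]
  -- These weights have row and column sums at most `1`: over `i` by Bessel for `u` and `v`, over
  -- `k` by Bessel for `e` and `f`, since `N* u_i` and `M v_i` have norm at most `1`.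
  have h := tsum_rpow_le_of_weights hp
    (fun k i => ENNReal.ofReal ‖⟪u i, N (e k)⟫_ℂ‖ *
      ENNReal.ofReal ‖⟪v i, ContinuousLinearMap.adjoint M (f k)⟫_ℂ‖)
    (fun i => ENNReal.ofReal (s i)) (fun k => ‖⟪f k, M (A (N (e k)))⟫_ℂ‖ₑ) ?_ ?_
  · refine h.trans (ENNReal.tsum_le_tsum fun i => ?_)
    rw [ENNReal.ofReal_rpow_of_nonneg (hs i) hp0.le]
    refine mul_le_of_le_one_left zero_le ?_
    refine tsum_mul_le_one_of_sq (fun _ => norm_nonneg _) (fun _ => norm_nonneg _) ?_ ?_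
    · intro t
      have := sum_norm_inner_sq_le_one he (le_one _ hN' _ (hu.1 i)) t
      simpa only [ContinuousLinearMap.adjoint_inner_right, norm_inner_symm (u i)] using this
    · intro t
      have := sum_norm_inner_sq_le_one hf (le_one _ hM _ (hv.1 i)) t
      simpa only [ContinuousLinearMap.adjoint_inner_right, norm_inner_symm (f _)] using this
  · intro k
    exact tsum_mul_le_one_of_sq (fun _ => norm_nonneg _) (fun _ => norm_nonneg _)
      (sum_norm_inner_sq_le_one hu (le_one _ hN _ (he.1 k)))
      (sum_norm_inner_sq_le_one hv (le_one _ hM' _ (hf.1 k)))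
  · intro k
    have h1 := hasSum_svd hu hA h0 (ContinuousLinearMap.adjoint M (f k)) (N (e k))
    rw [ContinuousLinearMap.adjoint_inner_left] at h1
    refine le_of_tendsto' (continuous_enorm.tendsto _ |>.comp h1) fun t => ?_
    refine (enorm_sum_le _ _).trans ?_
    refine le_trans (le_of_eq (Finset.sum_congr rfl fun i _ => ?_)) (ENNReal.sum_le_tsum t)
    rw [enorm_mul, enorm_mul, ofReal_norm, ofReal_norm, ← ofReal_norm (s i : ℂ),
      Complex.norm_real, Real.norm_of_nonneg (hs i),
      ← ofReal_norm (⟪ContinuousLinearMap.adjoint M (f k), v i⟫_ℂ), norm_inner_symm, ofReal_norm]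
    ring

/-- Bounds the singular sum from any diagonalisation, without identifying eigenspaces of `A* A`.
Zero values of `s` are allowed, so that entries can be deleted from a decomposition. -/
theorem singularSum_le_of_svd {p : ℝ} (hp : 1 ≤ p) {ι : Type*} {A : H →L[ℂ] H}
    (hAc : IsCompactOperator A) {s : ι → ℝ}
    {u v : ι → H} (hs : ∀ i, 0 ≤ s i) (hu : Orthonormal ℂ u) (hv : Orthonormal ℂ v)
    (hA : ∀ i, A (u i) = (s i : ℂ) • v i) (h0 : ∀ x, (∀ i, ⟪u i, x⟫_ℂ = 0) → A x = 0) :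
    singularSum p A ≤ ∑' i, ENNReal.ofReal (s i ^ p) := by
  obtain ⟨κ, e, f, he, hf, hS, -⟩ := exists_singularSum_eq A hAc
  rw [hS]
  have h1 : ‖ContinuousLinearMap.id ℂ H‖ ≤ 1 := ContinuousLinearMap.norm_id_le
  exact tsum_inner_contraction_le hp hs hu hv hA h0 h1 h1 he hf

theorem singularSum_contraction_le {p : ℝ} (hp : 1 ≤ p) {A M N : H →L[ℂ] H}
    (hA : IsCompactOperator A) (hM : ‖M‖ ≤ 1) (hN : ‖N‖ ≤ 1) :
    singularSum p (M ∘L A ∘L N) ≤ singularSum p A := by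
  obtain ⟨κ, e, f, he, hf, hS, -⟩ :=
    exists_singularSum_eq (M ∘L A ∘L N) ((hA.comp_clm N).clm_comp M)
  obtain ⟨ι, s, u, v, hs, hu, hv, hAu, h0, hS'⟩ := exists_svd A hA
  rw [hS, hS']
  exact tsum_inner_contraction_le hp (fun i => (hs i).le) hu hv hAu h0 hM hN he hf

/-- From `‖A* x‖² = ⟪x, A A* x⟫ ≤ ‖x‖ ‖A A* x‖`, a finite `ε² / 2`-net for the image of the unit
ball under `A A*` yields an `ε`-net for its image under `A*`; two points of the ball are at distance
at most `2`. -/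
theorem isCompactOperator_adjoint {A : H →L[ℂ] H} (hA : IsCompactOperator A) :
    IsCompactOperator (ContinuousLinearMap.adjoint A) := by
  set B := ContinuousLinearMap.adjoint A with hB
  have hAB : IsCompactOperator (A ∘L B) := hA.comp_clm B
  have hn : ∀ x, ‖B x‖ ^ 2 ≤ ‖x‖ * ‖A (B x)‖ := by
    intro x
    have h1 : ⟪x, A (B x)⟫_ℂ = ⟪B x, B x⟫_ℂ := by rw [hB, ContinuousLinearMap.adjoint_inner_left]
    have h2 := norm_inner_le_norm (𝕜 := ℂ) x (A (B x))
    rw [h1, inner_self_eq_norm_sq_to_K] at h2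
    simpa using h2
  have htb : TotallyBounded ((A ∘L B) '' Metric.closedBall 0 1) :=
    (hAB.isCompact_closure_image_closedBall (𝕜₁ := ℂ) (f := ((A ∘L B : H →L[ℂ] H) : H →ₗ[ℂ] H))
      1).totallyBounded.subset subset_closure
  have htb' : TotallyBounded (B '' Metric.closedBall 0 1) := by
    rw [Metric.totallyBounded_iff]
    intro ε hε
    obtain ⟨t, hts, htf, htc⟩ := Metric.finite_approx_of_totallyBounded htb (ε ^ 2 / 2)
      (by positivity)
    have hts' : ∀ y ∈ t, ∃ x, x ∈ Metric.closedBall (0 : H) 1 ∧ (A ∘L B) x = y := fun y hy => hts hy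
    choose! g hg1 hg2 using hts'
    refine ⟨(fun y => B (g y)) '' t, htf.image _, ?_⟩
    rintro _ ⟨x, hx, rfl⟩
    have := htc ⟨x, hx, rfl⟩
    simp only [Set.mem_iUnion, Metric.mem_ball, exists_prop] at this
    obtain ⟨y, hy, hxy⟩ := this
    simp only [Set.mem_iUnion, Metric.mem_ball, exists_prop, Set.exists_mem_image]
    refine ⟨y, hy, ?_⟩
    rw [← hg2 y hy, dist_eq_norm, ← map_sub] at hxy
    rw [dist_eq_norm, ← map_sub]
    have h1 := hn (x - g y)
    have h2 : ‖x - g y‖ ≤ 2 := by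
      have a1 := norm_sub_le x (g y)
      have a2 := hg1 y hy
      rw [mem_closedBall_zero_iff] at hx a2
      linarith
    refine lt_of_pow_lt_pow_left₀ 2 hε.le ?_
    have h3 : ‖A (B (x - g y))‖ < ε ^ 2 / 2 := hxy
    nlinarith [norm_nonneg (A (B (x - g y)))]
  have := isCompactOperator_iff_isCompact_closure_image_closedBall (𝕜₁ := ℂ) (B : H →ₗ[ℂ] H)
    (r := 1) one_pos
  exact this.2 (htb'.closure.isCompact_of_isClosed isClosed_closure)

theorem singularSum_adjoint_le {p : ℝ} (hp : 1 ≤ p) {A : H →L[ℂ] H} (hA : IsCompactOperator A) :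
    singularSum p (ContinuousLinearMap.adjoint A) ≤ singularSum p A := by
  obtain ⟨κ, e, f, he, hf, hS, -⟩ := exists_singularSum_eq _ (isCompactOperator_adjoint hA)
  rw [hS]
  refine le_trans (le_of_eq (tsum_congr fun k => ?_)) (tsum_inner_le_singularSum hp hA hf he)
  rw [ContinuousLinearMap.adjoint_inner_right, ← ofReal_norm, norm_inner_symm, ofReal_norm]

/-! ### Positive compact operators and McCarthy's inequality. -/

/-- Spectral decomposition of a positive compact operator. -/
theorem exists_eigenvectors {A : H →L[ℂ] H} (hA : IsCompactOperator A) (hpos : A.IsPositive) :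
    ∃ (ι : Type) (s : ι → ℝ) (u : ι → H), (∀ i, 0 < s i) ∧ Orthonormal ℂ u ∧
      (∀ i, A (u i) = (s i : ℂ) • u i) ∧ (∀ x, (∀ i, ⟪u i, x⟫_ℂ = 0) → A x = 0) ∧
      ∀ p : ℝ, singularSum p A = ∑' i, ENNReal.ofReal (s i ^ p) := by
  classical
  obtain ⟨ι, s, u, v, hs, hu, hv, hAu, h0, hS⟩ := exists_svd A hA
  have hAv : ∀ j, A (v j) = (s j : ℂ) • u j := by
    intro j
    refine ext_inner_right ℂ fun x => ?_
    rw [hpos.inner_left_eq_inner_right, inner_smul_left, Complex.conj_ofReal]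
    have h1 := hasSum_svd hu hAu h0 (v j) x
    have h2 := hasSum_single (f := fun i => ⟪u i, x⟫_ℂ * ((s i : ℂ) * ⟪v j, v i⟫_ℂ)) j
      fun i hi => by simp [hv.2 hi.symm]
    rw [h1.unique h2, inner_self_eq_norm_sq_to_K, hv.1 j]
    push_cast
    ring
  -- `A` swaps `u j` and `v j` up to the factor `s j`, so `v j - u j` satisfies the eigenvalue
  -- equation for `-s j < 0`; positivity forces it to vanish.
  have huv : ∀ j, v j = u j := by
    intro j
    have h1 : A (v j - u j) = -((s j : ℂ) • (v j - u j)) := by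
      rw [map_sub, hAu, hAv, smul_sub]
      abel
    have h2 := hpos.re_inner_nonneg_right (v j - u j)
    rw [h1, inner_neg_right, inner_smul_right, inner_self_eq_norm_sq_to_K] at h2
    have h3 : 0 ≤ -(s j * ‖v j - u j‖ ^ 2) := by
      have e : -((s j : ℂ) * ((‖v j - u j‖ : ℝ) : ℂ) ^ 2) = ((-(s j * ‖v j - u j‖ ^ 2) : ℝ) : ℂ) := by
        push_cast
        ring
      have h2' : 0 ≤ (-((s j : ℂ) * ((‖v j - u j‖ : ℝ) : ℂ) ^ 2)).re := h2
      rwa [e, Complex.ofReal_re] at h2'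
    have h4 : ‖v j - u j‖ ^ 2 = 0 := by
      have := hs j
      have h5 := sq_nonneg ‖v j - u j‖
      nlinarith
    exact sub_eq_zero.1 (norm_eq_zero.1 (pow_eq_zero_iff two_ne_zero |>.1 h4))
  exact ⟨ι, s, u, hs, hu, fun i => by rw [hAu, huv], h0, hS⟩

-- The quadratic form of `A` at `x - t A x` is `-2 t ‖A x‖² + t² b` with `b = ⟪A x, A (A x)⟫`; it
-- can be nonnegative for all real `t` only if its linear term vanishes.
omit [CompleteSpace H] in
theorem apply_eq_zero_of_isPositive {A : H →L[ℂ] H} (hA : A.IsPositive) {x : H}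
    (hx : (⟪x, A x⟫_ℂ).re = 0) : A x = 0 := by
  have hb := hA.re_inner_nonneg_right (A x)
  simp only [RCLike.re_eq_complex_re] at hb
  have h : ∀ t : ℝ, 0 ≤ -2 * t * ‖A x‖ ^ 2 + t ^ 2 * (⟪A x, A (A x)⟫_ℂ).re := by
    intro t
    have h1 := hA.re_inner_nonneg_right (x - (t : ℂ) • A x)
    have h2 : ⟪x, A (A x)⟫_ℂ = ⟪A x, A x⟫_ℂ := (hA.inner_left_eq_inner_right x (A x)).symm
    simp only [map_sub, map_smul, inner_sub_left, inner_sub_right, inner_smul_left,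
      inner_smul_right, Complex.conj_ofReal, h2, RCLike.re_eq_complex_re, Complex.sub_re,
      Complex.re_ofReal_mul, hx] at h1
    have h3 : (⟪A x, A x⟫_ℂ).re = ‖A x‖ ^ 2 := by
      rw [inner_self_eq_norm_sq_to_K]
      exact_mod_cast Complex.ofReal_re _
    rw [h3] at h1
    nlinarith
  set b := (⟪A x, A (A x)⟫_ℂ).re
  -- Close to the minimiser `‖A x‖² / b`; the `+ 1` covers `b = 0`.
  have h1 := h (‖A x‖ ^ 2 / (b + 1))
  have hb1 : 0 < b + 1 := by linarith
  have h2 : -2 * (‖A x‖ ^ 2 / (b + 1)) * ‖A x‖ ^ 2 + (‖A x‖ ^ 2 / (b + 1)) ^ 2 * b =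
      -((‖A x‖ ^ 2) ^ 2 * (b + 2)) / (b + 1) ^ 2 := by
    field_simp
    ring
  rw [h2, neg_div, neg_nonneg] at h1
  have h3 : (‖A x‖ ^ 2) ^ 2 * (b + 2) ≤ 0 := by
    by_contra hc
    exact absurd h1 (not_le.2 (div_pos (not_le.1 hc) (by positivity)))
  have h4 : (‖A x‖ ^ 2) ^ 2 = 0 := by nlinarith [sq_nonneg (‖A x‖ ^ 2)]
  simpa using h4

omit [CompleteSpace H] in
/-- If `X ≤ Z` and `x` is a unit eigenvector of `X`, then `ξ ⟨x, Z⁻¹ x⟩ ≤ 1`. -/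
theorem sum_inner_sq_div_le_one {ι : Type*} {X Z : H →L[ℂ] H} (hX : X.IsPositive)
    (hXZ : (Z - X).IsPositive) {ζ : ι → ℝ} {z : ι → H} (hζ : ∀ i, 0 < ζ i) (hz : Orthonormal ℂ z)
    (hZ : ∀ i, Z (z i) = (ζ i : ℂ) • z i) {ξ : ℝ} {x : H} (hx1 : ‖x‖ = 1)
    (hx : X x = (ξ : ℂ) • x) (t : Finset ι) : ∑ i ∈ t, ξ / ζ i * ‖⟪z i, x⟫_ℂ‖ ^ 2 ≤ 1 := by
  classical
  have hζ' : ∀ i, (ζ i : ℂ) ≠ 0 := fun i => by exact_mod_cast (hζ i).ne'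
  set m : ℝ := ∑ i ∈ t, ‖⟪z i, x⟫_ℂ‖ ^ 2 / ζ i with hm
  have hm0 : 0 ≤ m := Finset.sum_nonneg fun i _ => div_nonneg (sq_nonneg _) (hζ i).le
  have hgoal : ∑ i ∈ t, ξ / ζ i * ‖⟪z i, x⟫_ℂ‖ ^ 2 = ξ * m := by
    rw [hm, Finset.mul_sum]
    exact Finset.sum_congr rfl fun i _ => by ring
  rw [hgoal]
  -- A finite section of `Z⁻¹ x`, for which `⟪x, y⟫ = ⟪y, Z y⟫ = m`. Then `X ≤ Z` at `y` gives `⟪y,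
  -- X y⟫ ≤ m`, and `X ≥ 0` at `y - m x` gives `ξ m² ≤ ⟪y, X y⟫`; hence `ξ m ≤ 1`.
  set y : H := ∑ i ∈ t, (⟪z i, x⟫_ℂ / ζ i) • z i with hy
  have hconj : ∀ i, ⟪z i, x⟫_ℂ * ⟪x, z i⟫_ℂ = ((‖⟪z i, x⟫_ℂ‖ ^ 2 : ℝ) : ℂ) := by
    intro i
    rw [← inner_conj_symm x (z i), Complex.mul_conj, Complex.normSq_eq_norm_sq]
  have hxy : ⟪x, y⟫_ℂ = (m : ℂ) := by
    rw [hy, inner_sum, hm]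
    push_cast
    refine Finset.sum_congr rfl fun i _ => ?_
    rw [inner_smul_right, div_mul_eq_mul_div, hconj]
    push_cast
    rfl
  have hyx : ⟪y, x⟫_ℂ = (m : ℂ) := by
    rw [← inner_conj_symm, hxy, Complex.conj_ofReal]
  have hZy : Z y = ∑ i ∈ t, ⟪z i, x⟫_ℂ • z i := by
    rw [hy, map_sum]
    refine Finset.sum_congr rfl fun i _ => ?_
    rw [map_smul, hZ, smul_smul, div_mul_cancel₀ _ (hζ' i)]
  have hyZy : ⟪y, Z y⟫_ℂ = (m : ℂ) := by
    rw [hZy, hy, hz.inner_sum, hm]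
    push_cast
    refine Finset.sum_congr rfl fun i _ => ?_
    rw [map_div₀, inner_conj_symm, Complex.conj_ofReal, div_mul_eq_mul_div, mul_comm, hconj]
    push_cast
    rfl
  have hxx : ⟪x, x⟫_ℂ = 1 := by
    rw [inner_self_eq_norm_sq_to_K, hx1]
    simp
  have h1 := hXZ.re_inner_nonneg_right y
  have h2 := hX.re_inner_nonneg_right (y - (m : ℂ) • x)
  have h3 : ⟪x, X y⟫_ℂ = (ξ : ℂ) * m := by
    rw [← hX.inner_left_eq_inner_right, hx, inner_smul_left, Complex.conj_ofReal, hxy]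
  simp only [sub_apply, inner_sub_right, hyZy, RCLike.re_eq_complex_re,
    Complex.sub_re, Complex.ofReal_re] at h1
  simp only [map_sub, map_smul, inner_sub_left, inner_sub_right, inner_smul_left,
      inner_smul_right, Complex.conj_ofReal, h3, hx, hyx, hxx, RCLike.re_eq_complex_re,
      Complex.sub_re, Complex.re_ofReal_mul, Complex.ofReal_re, Complex.one_re] at h2
  by_contra hc
  have : 1 < ξ * m := not_le.1 hc
  have hmp : 0 < m := by
    rcases hm0.eq_or_lt with h | h
    · rw [← h] at this
      linarith
    · exact h
  nlinarith

/-- If `0 ≤ X ≤ Z` then `tr X ^ q` is bounded by the diagonal of `X` in an eigenbasis of `Z`, with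
the weights of `Z ^ (q - 1)`. -/
theorem singularSum_le_tsum_diagonal {q : ℝ} (hq : 1 ≤ q) {ι : Type*} {X Z : H →L[ℂ] H}
    (hXc : IsCompactOperator X) (hX : X.IsPositive) (hXZ : (Z - X).IsPositive)
    {ζ : ι → ℝ} {z : ι → H} (hζ : ∀ i, 0 < ζ i) (hz : Orthonormal ℂ z)
    (hZ : ∀ i, Z (z i) = (ζ i : ℂ) • z i) (h0 : ∀ x, (∀ i, ⟪z i, x⟫_ℂ = 0) → Z x = 0) :
    singularSum q X ≤
      ∑' i, ENNReal.ofReal ((⟪z i, X (z i)⟫_ℂ).re / ζ i) * ENNReal.ofReal (ζ i ^ q) := by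
  have hq0 : 0 < q := by linarith
  obtain ⟨κ, ξ, x, hξ, hx, hXx, hx0, hS⟩ := exists_eigenvectors hXc hX
  have hker : ∀ y, (∀ i, ⟪z i, y⟫_ℂ = 0) → X y = 0 := by
    intro y hy
    apply apply_eq_zero_of_isPositive hX
    have h1 := hXZ.re_inner_nonneg_right y
    have h2 := hX.re_inner_nonneg_right y
    simp only [sub_apply, h0 y hy, zero_sub, inner_neg_right, RCLike.re_eq_complex_re,
      Complex.neg_re] at h1 h2
    linarith
  -- With `d k i = (ξ k / ζ i) |⟪z i, x k⟫|²`, the sum over `i` is at most `1`, the sum over `k` is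
  -- at most `⟪z i, X (z i)⟫ / ζ i`, and averaging `ζ` with these weights dominates `ξ k`.
  have h := tsum_rpow_le_of_weights hq
    (fun k i => ENNReal.ofReal (ξ k / ζ i * ‖⟪z i, x k⟫_ℂ‖ ^ 2))
    (fun i => ENNReal.ofReal (ζ i)) (fun k => ENNReal.ofReal (ξ k)) ?_ ?_
  · rw [hS]
    refine le_trans (le_of_eq (tsum_congr fun k => ?_)) (h.trans (ENNReal.tsum_le_tsum fun i => ?_))
    · rw [ENNReal.ofReal_rpow_of_pos (hξ k)]
    · rw [ENNReal.ofReal_rpow_of_pos (hζ i)]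
      refine mul_le_mul_left ?_ _
      rw [ENNReal.tsum_eq_iSup_sum]
      refine iSup_le fun t => ?_
      have hnn : ∀ k, 0 ≤ ξ k / ζ i * ‖⟪z i, x k⟫_ℂ‖ ^ 2 := fun k =>
        mul_nonneg (div_nonneg (hξ k).le (hζ i).le) (sq_nonneg _)
      rw [← ENNReal.ofReal_sum_of_nonneg fun k _ => hnn k]
      apply ENNReal.ofReal_le_ofReal
      have h1 := Complex.hasSum_re (hasSum_svd hx hXx hx0 (z i) (z i))
      have h2 : ∀ k, (⟪x k, z i⟫_ℂ * ((ξ k : ℂ) * ⟪z i, x k⟫_ℂ)).re = ξ k * ‖⟪z i, x k⟫_ℂ‖ ^ 2 := by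
        intro k
        rw [mul_left_comm, mul_comm ⟪x k, z i⟫_ℂ, ← inner_conj_symm (x k) (z i), Complex.mul_conj,
          Complex.normSq_eq_norm_sq]
        rw [← Complex.ofReal_mul, Complex.ofReal_re]
      simp only [h2] at h1
      have h3 := sum_le_hasSum t (fun k _ => mul_nonneg (hξ k).le (sq_nonneg _)) h1
      refine le_trans (le_of_eq ?_) (div_le_div_of_nonneg_right h3 (hζ i).le)
      rw [Finset.sum_div]
      exact Finset.sum_congr rfl fun k _ => by ring
  · intro k
    rw [ENNReal.tsum_eq_iSup_sum]
    refine iSup_le fun t => ?_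
    have hnn : ∀ i, 0 ≤ ξ k / ζ i * ‖⟪z i, x k⟫_ℂ‖ ^ 2 := fun i =>
      mul_nonneg (div_nonneg (hξ k).le (hζ i).le) (sq_nonneg _)
    rw [← ENNReal.ofReal_sum_of_nonneg fun k _ => hnn k, ← ENNReal.ofReal_one]
    exact ENNReal.ofReal_le_ofReal
      (sum_inner_sq_div_le_one hX hXZ hζ hz hZ (hx.1 k) (hXx k) t)
  · intro k
    -- Not a singular value decomposition of `X`: with `s = 1` and `v i = X (z i)` the expansion
    -- merely develops `x k` along `z`, which is legitimate because `X` vanishes on the complement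
    -- by `hker`.
    have h1 := hasSum_svd (A := X) (s := fun _ => 1) (v := fun i => X (z i)) hz
      (fun i => by simp) hker (x k) (x k)
    have h2 : ‖⟪x k, X (x k)⟫_ℂ‖ₑ = ENNReal.ofReal (ξ k) := by
      rw [hXx, inner_smul_right, inner_self_eq_norm_sq_to_K, hx.1 k, ← ofReal_norm]
      simp [abs_of_pos (hξ k)]
    rw [← h2]
    refine le_of_tendsto' (continuous_enorm.tendsto _ |>.comp h1) fun t => ?_
    refine (enorm_sum_le _ _).trans ?_
    refine le_trans (le_of_eq (Finset.sum_congr rfl fun i _ => ?_)) (ENNReal.sum_le_tsum t)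
    rw [← ENNReal.ofReal_mul' (hζ i).le, ← ofReal_norm, ← hX.inner_left_eq_inner_right, hXx,
      inner_smul_left, norm_mul, norm_mul, norm_mul, norm_inner_symm (x k)]
    congr 1
    have := (hζ i).ne'
    simp only [Complex.ofReal_one, norm_one, RCLike.norm_conj, Complex.norm_real,
      Real.norm_of_nonneg (hξ k).le]
    field_simp

/-- McCarthy's inequality `tr X ^ q + tr Y ^ q ≤ tr (X + Y) ^ q`. -/
theorem singularSum_add_ge {q : ℝ} (hq : 1 ≤ q) {X Y : H →L[ℂ] H}
    (hXc : IsCompactOperator X) (hX : X.IsPositive) (hYc : IsCompactOperator Y)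
    (hY : Y.IsPositive) : singularSum q X + singularSum q Y ≤ singularSum q (X + Y) := by
  obtain ⟨ι, ζ, z, hζ, hz, hZ, h0, hS⟩ := exists_eigenvectors (hXc.add hYc) (hX.add hY)
  have h1 := singularSum_le_tsum_diagonal hq hXc hX (by simpa using hY) hζ hz hZ h0
  have h2 := singularSum_le_tsum_diagonal hq hYc hY (by simpa using hX) hζ hz hZ h0
  refine (add_le_add h1 h2).trans (le_of_eq ?_)
  rw [hS, ← ENNReal.tsum_add]
  refine tsum_congr fun i => ?_
  have hx : 0 ≤ (⟪z i, X (z i)⟫_ℂ).re := hX.re_inner_nonneg_right (z i)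
  have hy : 0 ≤ (⟪z i, Y (z i)⟫_ℂ).re := hY.re_inner_nonneg_right (z i)
  -- The diagonal entries of `X` and `Y` at `z i` add up to `ζ i`, so the two weights sum to `1`.
  rw [← add_mul, ← ENNReal.ofReal_add (div_nonneg hx (hζ i).le) (div_nonneg hy (hζ i).le),
    ← add_div, ← Complex.add_re, ← inner_add_right, ← add_apply, hZ, inner_smul_right,
    inner_self_eq_norm_sq_to_K, hz.1 i]
  simp [div_self (hζ i).ne']

/-- McCarthy's inequality for `X` and `Z - X`, with the second term dropped. -/
theorem singularSum_mono {q : ℝ} (hq : 1 ≤ q) {X Z : H →L[ℂ] H}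
    (hXc : IsCompactOperator X) (hX : X.IsPositive) (hZc : IsCompactOperator Z)
    (hXZ : (Z - X).IsPositive) : singularSum q X ≤ singularSum q Z := by
  have h := singularSum_add_ge hq hXc hX (hZc.sub hXc) hXZ
  have e : X + (Z - X) = Z := by abel
  exact le_self_add.trans (by rwa [← e])

/-! ### Orthogonal sums and finite-rank truncation. -/

/-- Positive operators with orthogonal ranges. -/
theorem singularSum_add_le_of_mul_eq_zero {p : ℝ} (hp : 1 ≤ p) {S B : H →L[ℂ] H}
    (hSc : IsCompactOperator S) (hS : S.IsPositive) (hBc : IsCompactOperator B)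
    (hB : B.IsPositive) (hSB : ∀ x, S (B x) = 0) :
    singularSum p (S + B) ≤ singularSum p S + singularSum p B := by
  obtain ⟨ι, s, u, hs, hu, hSu, hu0, hs'⟩ := exists_eigenvectors hSc hS
  obtain ⟨κ, t, w, ht, hw, hBw, hw0, ht'⟩ := exists_eigenvectors hBc hB
  have hsn : ∀ i, (s i : ℂ) ≠ 0 := fun i => by exact_mod_cast (hs i).ne'
  have htn : ∀ i, (t i : ℂ) ≠ 0 := fun i => by exact_mod_cast (ht i).ne'
  have hSw : ∀ j, S (w j) = 0 := by
    intro j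
    have := hSB (w j)
    rw [hBw, map_smul] at this
    exact (smul_eq_zero.1 this).resolve_left (htn j)
  have hBu : ∀ i, B (u i) = 0 := by
    intro i
    refine ext_inner_right ℂ fun x => ?_
    have h1 : ⟪S (u i), B x⟫_ℂ = 0 := by
      rw [hS.inner_left_eq_inner_right, hSB, inner_zero_right]
    rw [hSu, inner_smul_left, Complex.conj_ofReal] at h1
    rw [hB.inner_left_eq_inner_right, inner_zero_left]
    exact (mul_eq_zero.1 h1).resolve_left (hsn i)
  have huw : ∀ i j, ⟪u i, w j⟫_ℂ = 0 := by
    intro i j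
    have h1 : ⟪S (u i), w j⟫_ℂ = 0 := by
      rw [hS.inner_left_eq_inner_right, hSw, inner_zero_right]
    rw [hSu, inner_smul_left, Complex.conj_ofReal] at h1
    exact (mul_eq_zero.1 h1).resolve_left (hsn i)
  have huw' : ∀ i j, ⟪w j, u i⟫_ℂ = 0 := fun i j => inner_eq_zero_symm.1 (huw i j)
  -- The two eigenvector systems are mutually orthogonal, so together they diagonalise `S + B`.
  have hon : Orthonormal ℂ (Sum.elim u w) := by
    constructor
    · rintro (i | j)
      · exact hu.1 i
      · exact hw.1 j
    · rintro (i | i) (j | j) hij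
      · exact hu.2 fun h => hij (by rw [h])
      · exact huw i j
      · exact huw' j i
      · exact hw.2 fun h => hij (by rw [h])
  have h := singularSum_le_of_svd hp (A := S + B) (hSc.add hBc) (s := Sum.elim s t) (u := Sum.elim u w)
    (v := Sum.elim u w) ?_ hon hon ?_ ?_
  · refine h.trans (le_of_eq ?_)
    rw [Summable.tsum_sum ENNReal.summable ENNReal.summable, hs', ht']
    rfl
  · rintro (i | j)
    · exact (hs i).le
    · exact (ht j).le
  · rintro (i | j)
    · simp [hSu, hBu]
    · simp [hSw, hBw]
  · intro x hx
    rw [add_apply, hu0 x fun i => hx (Sum.inl i), hw0 x fun j => hx (Sum.inr j), add_zero]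

/-- Truncation of a positive operator in the Schatten class to finite rank. -/
theorem exists_finiteDimensional_singularSum_sub_lt {p : ℝ} (hp : 1 ≤ p) {A : H →L[ℂ] H}
    (hA : IsCompactOperator A) (hpos : A.IsPositive) (hfin : singularSum p A < ∞) {ε : ℝ≥0∞}
    (hε : 0 < ε) :
    ∃ (V : Submodule ℂ H) (_ : FiniteDimensional ℂ V), (∀ x, A x = 0 → V.starProjection x = 0) ∧
      singularSum p (A - V.starProjection ∘L A ∘L V.starProjection) < ε := by
  classical
  have hp0 : 0 < p := by linarith
  obtain ⟨ι, s, u, hs, hu, hAu, hu0, hS⟩ := exists_eigenvectors hA hpos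
  rw [hS] at hfin
  -- `F` carries all of `∑ s_i ^ p` up to a tail below `ε`; `V` is spanned by the corresponding
  -- eigenvectors, so the truncation error is `A` with the eigenvalues in `F` replaced by `0`.
  obtain ⟨F, hF⟩ := ((tendsto_order.1 (ENNReal.tendsto_tsum_compl_atTop_zero hfin.ne)).2 ε
    hε).exists
  have hsn : ∀ i, (s i : ℂ) ≠ 0 := fun i => by exact_mod_cast (hs i).ne'
  let V : Submodule ℂ H := Submodule.span ℂ (F.image u : Finset H)
  have hV : FiniteDimensional ℂ V := FiniteDimensional.span_finset ℂ _
  have hVo : ∀ x, (∀ i ∈ F, ⟪u i, x⟫_ℂ = 0) → V.starProjection x = 0 := by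
    intro x hx
    rw [Submodule.starProjection_apply_eq_zero_iff]
    have : (V : Submodule ℂ H) ≤ (Submodule.span ℂ {x})ᗮ := by
      refine Submodule.span_le.2 ?_
      intro y hy
      simp only [Finset.coe_image, Set.mem_image] at hy
      obtain ⟨i, hi, rfl⟩ := hy
      rw [SetLike.mem_coe, Submodule.mem_orthogonal_singleton_iff_inner_left]
      exact hx i hi
    rw [Submodule.mem_orthogonal]
    intro y hy
    exact Submodule.mem_orthogonal_singleton_iff_inner_left.1 (this hy)
  have hP1 : ∀ i ∈ F, V.starProjection (u i) = u i := by
    intro i hi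
    rw [Submodule.starProjection_eq_self_iff]
    exact Submodule.subset_span (by simpa using ⟨i, hi, rfl⟩)
  have hP0 : ∀ i ∉ F, V.starProjection (u i) = 0 := by
    intro i hi
    exact hVo _ fun j hj => hu.2 fun h => hi (h ▸ hj)
  refine ⟨V, hV, fun x hx => hVo x fun i _ => ?_, ?_⟩
  · have h1 : ⟪A (u i), x⟫_ℂ = 0 := by rw [hpos.inner_left_eq_inner_right, hx, inner_zero_right]
    rw [hAu, inner_smul_left, Complex.conj_ofReal] at h1
    exact (mul_eq_zero.1 h1).resolve_left (hsn i)
  refine lt_of_le_of_lt ?_ hF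
  have h := singularSum_le_of_svd hp
    (A := A - V.starProjection ∘L A ∘L V.starProjection)
    (hA.sub ((hA.comp_clm V.starProjection).clm_comp V.starProjection))
    (s := fun i => if i ∈ F then 0 else s i) (u := u) (v := u) ?_ hu hu ?_ ?_
  · refine h.trans (le_of_eq ?_)
    have e := tsum_subtype {i | i ∉ F} fun i => ENNReal.ofReal (s i ^ p)
    refine Eq.trans (tsum_congr fun i => ?_) e.symm
    by_cases hi : i ∈ F
    · simp [hi, Real.zero_rpow hp0.ne']
    · simp [hi]
  · intro i
    split_ifs
    · exact le_rfl
    · exact (hs i).le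
  · intro i
    by_cases hi : i ∈ F
    · simp [hi, hP1, hAu]
    · simp [hi, hP0, hAu]
  · intro x hx
    simp [hu0 x hx, hVo x fun i _ => hx i]

end Schatten

/-! ### Completeness of the Schatten spaces. -/

noncomputable section

open Schatten

namespace SchattenClass

variable {p : ℝ} [hp : Fact (1 ≤ p)] {H : Type*} [NormedAddCommGroup H] [InnerProductSpace ℂ H]
  [CompleteSpace H]

/-- A compact operator with `∑ i, s_i(A) ^ p < ∞` as an element of `S_p(H)`. -/
def ofOperator (A : H →L[ℂ] H) (hA : IsCompactOperator A) (hfin : singularSum p A < ∞) :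
    SchattenClass p H :=
  (⟨A, hA, hfin⟩ : schattenSubmodule p H)

@[simp]
theorem toOperator_ofOperator (A : H →L[ℂ] H) (hA : IsCompactOperator A)
    (hfin : singularSum p A < ∞) : toOperator (ofOperator A hA hfin) = A := rfl

theorem exponent_pos (p : ℝ) [hp : Fact (1 ≤ p)] : 0 < p := lt_of_lt_of_le one_pos hp.out

theorem singularSum_toOperator (A : SchattenClass p H) :
    singularSum p (toOperator A) = ENNReal.ofReal (‖A‖ ^ p) := by
  have hp0 := exponent_pos p
  rw [norm_def, ← Real.rpow_mul ENNReal.toReal_nonneg, one_div_mul_cancel hp0.ne', Real.rpow_one,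
    ENNReal.ofReal_toReal A.singularSum_lt_top.ne]

theorem singularSum_le_ofReal_iff (A : SchattenClass p H) {r : ℝ} (hr : 0 ≤ r) :
    singularSum p (toOperator A) ≤ ENNReal.ofReal (r ^ p) ↔ ‖A‖ ≤ r := by
  rw [singularSum_toOperator, ENNReal.ofReal_le_ofReal_iff (Real.rpow_nonneg hr p),
    Real.rpow_le_rpow_iff (norm_nonneg A) hr (exponent_pos p)]

theorem norm_le_norm_of_singularSum_le {K : Type*} [NormedAddCommGroup K] [InnerProductSpace ℂ K]
    [CompleteSpace K] {A : SchattenClass p H} {B : SchattenClass p K}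
    (h : singularSum p (toOperator A) ≤ singularSum p (toOperator B)) : ‖A‖ ≤ ‖B‖ := by
  rwa [singularSum_toOperator B, singularSum_le_ofReal_iff A (norm_nonneg B)] at h

/-- The matrix-entry inequality for the one-element families `x / ‖x‖` and `A x / ‖A x‖`. -/
theorem norm_toOperator_le (A : SchattenClass p H) : ‖toOperator A‖ ≤ ‖A‖ := by
  refine ContinuousLinearMap.opNorm_le_bound _ (norm_nonneg A) fun x => ?_
  have hp0 := exponent_pos p
  rcases eq_or_ne x 0 with rfl | hx
  · simp
  rcases eq_or_ne (toOperator A x) 0 with h0 | h0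
  · rw [h0, norm_zero]
    positivity
  set y := toOperator A x with hy
  have hx' : 0 < ‖x‖ := norm_pos_iff.2 hx
  have hy' : 0 < ‖y‖ := norm_pos_iff.2 h0
  have on : ∀ w : H, w ≠ 0 → Orthonormal ℂ (fun _ : Unit => ((‖w‖⁻¹ : ℝ) : ℂ) • w) := by
    intro w hw
    refine ⟨fun _ => ?_, fun i j hij => absurd (Subsingleton.elim i j) hij⟩
    rw [norm_smul, Complex.norm_real, norm_inv, norm_norm, inv_mul_cancel₀ (norm_ne_zero_iff.2 hw)]
  have h := tsum_inner_le_singularSum hp.out A.isCompactOperator (on x hx) (on y h0)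
  rw [tsum_fintype, Finset.univ_unique, Finset.sum_singleton, map_smul, inner_smul_left,
    inner_smul_right, ← hy, inner_self_eq_norm_sq_to_K, singularSum_toOperator,
    ← ENNReal.ofReal_rpow_of_nonneg (norm_nonneg A) hp0.le,
    ENNReal.rpow_le_rpow_iff hp0, ← ofReal_norm, ENNReal.ofReal_le_ofReal_iff (norm_nonneg A)] at h
  have e : ‖(starRingEnd ℂ) ((‖y‖⁻¹ : ℝ) : ℂ) * (((‖x‖⁻¹ : ℝ) : ℂ) * ((‖y‖ : ℝ) : ℂ) ^ 2)‖ =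
      ‖y‖ / ‖x‖ := by
    rw [Complex.conj_ofReal]
    norm_cast
    rw [Real.norm_of_nonneg (by positivity)]
    field_simp
  have h' : ‖y‖ / ‖x‖ ≤ ‖A‖ := e ▸ h
  rwa [div_le_iff₀ hx'] at h'

/-- The inclusion of `S_p(H)` into the bounded operators as a continuous linear map. -/
def toOperatorCLM : SchattenClass p H →L[ℂ] (H →L[ℂ] H) :=
  toOperator.mkContinuous 1 fun A => by simpa using norm_toOperator_le A

/-- Lower semicontinuity in the operator norm: the singular sum of `A` is a supremum of finite sums
of matrix entries, each continuous in the operator and bounded by the singular sum. -/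
theorem singularSum_le_of_tendsto {α : Type*} {l : Filter α} [l.NeBot] {B : α → H →L[ℂ] H}
    {A : H →L[ℂ] H} (hAc : IsCompactOperator A) (hB : ∀ a, IsCompactOperator (B a))
    (hlim : Filter.Tendsto B l (nhds A)) {C : ℝ≥0∞} (hC : ∀ᶠ a in l, singularSum p (B a) ≤ C) :
    singularSum p A ≤ C := by
  obtain ⟨κ, e, f, he, hf, hS, -⟩ := exists_singularSum_eq A hAc
  rw [hS, ENNReal.tsum_eq_iSup_sum]
  refine iSup_le fun t => ?_
  have h1 : Filter.Tendsto (fun a => ∑ k ∈ t, ‖⟪f k, B a (e k)⟫_ℂ‖ₑ ^ p) l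
      (nhds (∑ k ∈ t, ‖⟪f k, A (e k)⟫_ℂ‖ₑ ^ p)) := by
    refine tendsto_finsetSum _ fun k _ => ?_
    have hc : Continuous fun L : H →L[ℂ] H => ‖⟪f k, L (e k)⟫_ℂ‖ₑ ^ p := by
      refine (ENNReal.continuous_rpow_const (y := p)).comp (continuous_enorm.comp ?_)
      fun_prop
    exact (hc.tendsto A).comp hlim
  refine le_of_tendsto h1 (hC.mono fun a ha => ?_)
  exact ((ENNReal.sum_le_tsum t).trans
    (tsum_inner_le_singularSum hp.out (hB a) he hf)).trans ha

/-- Needed for the codomain, so that norm limits of compact maps are compact. The limit is taken in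
operator norm and upgraded to the Schatten norm by lower semicontinuity. -/
instance instCompleteSpace : CompleteSpace (SchattenClass p H) := by
  refine Metric.complete_of_cauchySeq_tendsto fun u hu => ?_
  have hu' : CauchySeq fun n => toOperator (u n) :=
    (toOperatorCLM (p := p) (H := H)).uniformContinuous.comp_cauchySeq hu
  obtain ⟨A, hA⟩ := cauchySeq_tendsto_of_complete hu'
  have hAc : IsCompactOperator A :=
    isCompactOperator_of_tendsto hA (Filter.Eventually.of_forall fun n => (u n).isCompactOperator)
  have key : ∀ ε > 0, ∃ N, ∀ n ≥ N,
      singularSum p (toOperator (u n) - A) ≤ ENNReal.ofReal (ε ^ p) := by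
    intro ε hε
    obtain ⟨N, hN⟩ := Metric.cauchySeq_iff.1 hu ε hε
    refine ⟨N, fun n hn => ?_⟩
    refine singularSum_le_of_tendsto (l := Filter.atTop) (B := fun m => toOperator (u n - u m))
      ((u n).isCompactOperator.sub hAc) (fun m => (u n - u m).isCompactOperator) ?_ ?_
    · simp only [map_sub]
      exact tendsto_const_nhds.sub hA
    · filter_upwards [Filter.eventually_ge_atTop N] with m hm
      rw [singularSum_le_ofReal_iff _ hε.le, ← dist_eq_norm]
      exact (hN n hn m hm).le
  obtain ⟨N, hN⟩ := key 1 one_pos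
  have hfin : singularSum p A < ∞ := by
    let D : SchattenClass p H := ofOperator (toOperator (u N) - A)
      ((u N).isCompactOperator.sub hAc) ((hN N le_rfl).trans_lt ENNReal.ofReal_lt_top)
    have h := (u N - D).singularSum_lt_top
    simpa [D] using h
  refine ⟨ofOperator A hAc hfin, Metric.tendsto_atTop.2 fun ε hε => ?_⟩
  obtain ⟨M, hM⟩ := key (ε / 2) (half_pos hε)
  refine ⟨M, fun n hn => ?_⟩
  rw [dist_eq_norm]
  refine lt_of_le_of_lt ?_ (half_lt_self hε)
  rw [← singularSum_le_ofReal_iff _ (half_pos hε).le, map_sub, toOperator_ofOperator]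
  exact hM n hn

/-! ### Compressions and decomposition into positive parts. -/

/-- The compression `A ↦ M A M` by a contraction `M`. -/
def compression (p : ℝ) [hp : Fact (1 ≤ p)] (M : H →L[ℂ] H) (hM : ‖M‖ ≤ 1) :
    SchattenClass p H →L[ℂ] SchattenClass p H :=
  LinearMap.mkContinuous
    { toFun := fun A => ofOperator (M ∘L toOperator A ∘L M)
        ((A.isCompactOperator.comp_clm M).clm_comp M)
        ((singularSum_contraction_le hp.out A.isCompactOperator hM hM).trans_lt
          A.singularSum_lt_top)
      map_add' := fun A B => toOperator_injective <| ContinuousLinearMap.ext fun x =>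
        map_add M (toOperator A (M x)) (toOperator B (M x))
      map_smul' := fun c A => toOperator_injective <| ContinuousLinearMap.ext fun x =>
        map_smul M c (toOperator A (M x)) } 1
    fun A => by
      rw [one_mul]
      exact norm_le_norm_of_singularSum_le
        (singularSum_contraction_le hp.out A.isCompactOperator hM hM)

@[simp]
theorem toOperator_compression {M : H →L[ℂ] H} (hM : ‖M‖ ≤ 1) (A : SchattenClass p H) :
    toOperator (compression p M hM A) = M ∘L toOperator A ∘L M := rfl

theorem norm_compression_le {M : H →L[ℂ] H} (hM : ‖M‖ ≤ 1) (A : SchattenClass p H) :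
    ‖compression p M hM A‖ ≤ ‖A‖ :=
  norm_le_norm_of_singularSum_le (singularSum_contraction_le hp.out A.isCompactOperator hM hM)

theorem exists_adjoint (A : SchattenClass p H) :
    ∃ B : SchattenClass p H, toOperator B = ContinuousLinearMap.adjoint (toOperator A) ∧
      ‖B‖ ≤ ‖A‖ :=
  ⟨ofOperator _ (isCompactOperator_adjoint A.isCompactOperator)
    ((singularSum_adjoint_le hp.out A.isCompactOperator).trans_lt A.singularSum_lt_top), rfl,
    norm_le_norm_of_singularSum_le (singularSum_adjoint_le hp.out A.isCompactOperator)⟩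

/-- Let `U` be the kernel of `a⁺`. Since `a⁺ a⁻ = 0`, the range of `a⁻` lies in `U`, so compressing
`a` to `U` gives `-a⁻` and compressing to `Uᗮ` gives `a⁺`. Membership in the Schatten class and the
norm bounds come from the compressions. -/
theorem exists_positive_sub (A : SchattenClass p H) (hA : IsSelfAdjoint (toOperator A)) :
    ∃ B C : SchattenClass p H, (toOperator B).IsPositive ∧ (toOperator C).IsPositive ∧
      ‖B‖ ≤ ‖A‖ ∧ ‖C‖ ≤ ‖A‖ ∧ A = B - C := by
  set a := toOperator A with ha
  have hsub : a⁺ - a⁻ = a := CFC.posPart_sub_negPart a hA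
  have hmul : a⁺ * a⁻ = 0 := CFC.posPart_mul_negPart a
  have hP : (a⁺).IsPositive := (ContinuousLinearMap.nonneg_iff_isPositive _).1 (CFC.posPart_nonneg a)
  have hN : (a⁻).IsPositive := (ContinuousLinearMap.nonneg_iff_isPositive _).1 (CFC.negPart_nonneg a)
  let U : Submodule ℂ H := LinearMap.ker (a⁺ : H →L[ℂ] H).toLinearMap
  have hUc : IsClosed (U : Set H) := (a⁺).isClosed_ker
  have : CompleteSpace U := hUc.completeSpace_coe
  have hPU : ∀ x, a⁺ (U.starProjection x) = 0 := fun x => U.starProjection_apply_mem x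
  have hNU : ∀ x, U.starProjection (a⁻ x) = a⁻ x := by
    intro x
    rw [Submodule.starProjection_eq_self_iff]
    change a⁺ (a⁻ x) = 0
    exact congrArg (fun L : H →L[ℂ] H => L x) hmul
  have hUP : ∀ x, U.starProjection (a⁺ x) = 0 := by
    intro x
    refine ext_inner_right ℂ fun y => ?_
    rw [Submodule.inner_starProjection_left_eq_right, hP.inner_left_eq_inner_right, hPU,
      inner_zero_left, inner_zero_right]
  have hNU' : ∀ x, a⁻ (U.starProjection x) = a⁻ x := by
    intro x
    refine ext_inner_right ℂ fun y => ?_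
    rw [hN.inner_left_eq_inner_right, Submodule.inner_starProjection_left_eq_right, hNU,
      hN.inner_left_eq_inner_right]
  have hU1 : ‖U.starProjection‖ ≤ 1 := U.starProjection_norm_le
  have hC : toOperator (compression p U.starProjection hU1 A) = -a⁻ := by
    ext x
    rw [toOperator_compression, ← ha]
    have hx : ∀ y, a y = a⁺ y - a⁻ y := fun y => congrArg (fun L : H →L[ℂ] H => L y) hsub.symm
    simp [hx, hPU, hNU, hNU']
  have hle : ‖-compression p U.starProjection hU1 A‖ ≤ ‖A‖ := by
    rw [norm_neg]
    exact norm_compression_le hU1 A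
  have hU1' : ‖Uᗮ.starProjection‖ ≤ 1 := Uᗮ.starProjection_norm_le
  have hB : toOperator (compression p Uᗮ.starProjection hU1' A) = a⁺ := by
    ext x
    rw [toOperator_compression, ← ha]
    have hx : ∀ y, a y = a⁺ y - a⁻ y := fun y => congrArg (fun L : H →L[ℂ] H => L y) hsub.symm
    simp [Submodule.starProjection_orthogonal_val, hx, hPU, hNU', hUP]
  refine ⟨compression p Uᗮ.starProjection hU1' A, -compression p U.starProjection hU1 A, ?_, ?_,
    norm_compression_le hU1' A, hle, ?_⟩
  · rwa [hB]
  · rw [map_neg, hC, neg_neg]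
    exact hN
  · apply toOperator_injective
    rw [map_sub, map_neg, hB, hC, neg_neg, hsub]

/-- Real and imaginary parts `(A + A*) / 2` and `-i (A - A*) / 2`, each split into positive and
negative parts. -/
theorem exists_positive_decomposition (A : SchattenClass p H) :
    ∃ B : Fin 4 → SchattenClass p H, (∀ i, (toOperator (B i)).IsPositive ∧ ‖B i‖ ≤ ‖A‖) ∧
      A = B 0 - B 1 + Complex.I • (B 2 - B 3) := by
  obtain ⟨D, hD, hDn⟩ := exists_adjoint A
  have hn1 : ‖(2⁻¹ : ℂ) • (A + D)‖ ≤ ‖A‖ := by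
    have := norm_add_le A D
    rw [norm_smul]
    norm_num
    linarith
  have hn2 : ‖(-(Complex.I * 2⁻¹)) • (A - D)‖ ≤ ‖A‖ := by
    have := norm_sub_le A D
    rw [norm_smul]
    norm_num
    linarith
  have hs1 : IsSelfAdjoint (toOperator ((2⁻¹ : ℂ) • (A + D))) := by
    rw [ContinuousLinearMap.isSelfAdjoint_iff', map_smul, map_add, hD, map_smulₛₗ, map_add,
      ContinuousLinearMap.adjoint_adjoint, add_comm, map_inv₀, Complex.conj_ofNat]
  have hs2 : IsSelfAdjoint (toOperator ((-(Complex.I * 2⁻¹)) • (A - D))) := by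
    rw [ContinuousLinearMap.isSelfAdjoint_iff', map_smul, map_sub, hD, map_smulₛₗ, map_sub,
      ContinuousLinearMap.adjoint_adjoint]
    simp only [map_neg, map_mul, Complex.conj_I, map_inv₀, Complex.conj_ofNat]
    rw [← neg_sub (toOperator A), smul_neg, ← neg_smul]
    ring_nf
  obtain ⟨B0, B1, h0, h1, n0, n1, e1⟩ := exists_positive_sub _ hs1
  obtain ⟨B2, B3, h2, h3, n2, n3, e2⟩ := exists_positive_sub _ hs2
  refine ⟨![B0, B1, B2, B3], ?_, ?_⟩
  · intro i
    fin_cases i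
    · exact ⟨h0, n0.trans hn1⟩
    · exact ⟨h1, n1.trans hn1⟩
    · exact ⟨h2, n2.trans hn2⟩
    · exact ⟨h3, n3.trans hn2⟩
  · change A = B0 - B1 + Complex.I • (B2 - B3)
    rw [← e1, ← e2, smul_smul]
    have : Complex.I * -(Complex.I * 2⁻¹) = 2⁻¹ := by
      rw [mul_neg, ← mul_assoc, Complex.I_mul_I]
      ring
    rw [this, ← smul_add, add_add_sub_cancel, ← two_smul ℂ A, smul_smul]
    norm_num

end SchattenClass

/-! ### Smallness of a positive map off a finite-dimensional subspace. -/

namespace SchattenClass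

variable {p q : ℝ} [hp : Fact (1 ≤ p)] [hq : Fact (1 ≤ q)]
  {H : Type*} [NormedAddCommGroup H] [InnerProductSpace ℂ H] [CompleteSpace H]
  {K : Type*} [NormedAddCommGroup K] [InnerProductSpace ℂ K] [CompleteSpace K]

omit [CompleteSpace H] in
theorem isPositive_real_smul {A : H →L[ℂ] H} (hA : A.IsPositive) {c : ℝ} (hc : 0 ≤ c) :
    ((c : ℂ) • A).IsPositive :=
  hA.smul_of_nonneg (by exact_mod_cast hc)

theorem isPositive_compression {V : Submodule ℂ H} [V.HasOrthogonalProjection]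
    {A : SchattenClass p H} (hA : (toOperator A).IsPositive) :
    (toOperator (compression p V.starProjection V.starProjection_norm_le A)).IsPositive := by
  have h := hA.conj_starProjection V
  exact h

/-- If the image of a positive operator vanishing on `V` is large, then so is that of a positive
contraction of finite rank vanishing on `V`. -/
theorem exists_finiteRank_lt_norm (T : SchattenClass p H →L[ℂ] SchattenClass q K) {δ : ℝ}
    {A : SchattenClass p H} (hA : (toOperator A).IsPositive) (hδA : δ * ‖A‖ < ‖T A‖) :
    ∃ B : SchattenClass p H, (toOperator B).IsPositive ∧
      (∀ x, toOperator A x = 0 → toOperator B x = 0) ∧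
      (∃ (W : Submodule ℂ H) (_ : FiniteDimensional ℂ W), ∀ x, toOperator B x ∈ W) ∧
      ‖B‖ ≤ 1 ∧ δ < ‖T B‖ := by
  have hA0 : 0 < ‖A‖ := by
    rw [norm_pos_iff]
    rintro rfl
    simp at hδA
  set c : ℝ := ‖A‖⁻¹ with hc
  have hc0 : 0 < c := inv_pos.2 hA0
  set A' : SchattenClass p H := (c : ℂ) • A with hA'
  have hcn : ‖(c : ℂ)‖ = c := by rw [Complex.norm_real, Real.norm_of_nonneg hc0.le]
  have hn : ‖A'‖ = 1 := by rw [hA', norm_smul, hcn, inv_mul_cancel₀ hA0.ne']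
  have hTn : δ < ‖T A'‖ := by
    rw [hA', map_smul, norm_smul, hcn, hc, inv_mul_eq_div, lt_div_iff₀ hA0]
    exact hδA
  have hpos : (toOperator A').IsPositive := by
    rw [hA', map_smul]
    exact isPositive_real_smul hA hc0.le
  -- Truncating within `η` costs at most `‖T‖ η` in the image, strictly less than the gap `‖T A'‖ -
  -- δ` thanks to the `+ 1`.
  set η : ℝ := (‖T A'‖ - δ) / (‖T‖ + 1) with hη
  have hT1 : 0 < ‖T‖ + 1 := by positivity
  have hη0 : 0 < η := div_pos (sub_pos.2 hTn) hT1
  obtain ⟨V, hV, hVker, hVs⟩ := exists_finiteDimensional_singularSum_sub_lt hp.out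
    A'.isCompactOperator hpos A'.singularSum_lt_top
    (ε := ENNReal.ofReal (η ^ p)) (ENNReal.ofReal_pos.2 (Real.rpow_pos_of_pos hη0 p))
  set B := compression p V.starProjection V.starProjection_norm_le A' with hB
  refine ⟨B, isPositive_compression hpos, fun x hx => ?_, ⟨V, hV, fun x => ?_⟩, ?_, ?_⟩
  · rw [hB, toOperator_compression, ContinuousLinearMap.comp_apply, ContinuousLinearMap.comp_apply,
      hVker x (by rw [hA', map_smul, smul_apply, hx, smul_zero]), map_zero, map_zero]
  · rw [hB, toOperator_compression, ContinuousLinearMap.comp_apply]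
    exact V.starProjection_apply_mem _
  · exact (norm_compression_le _ A').trans hn.le
  · have h1 : ‖A' - B‖ ≤ η := by
      rw [← singularSum_le_ofReal_iff _ hη0.le, map_sub]
      exact hVs.le
    have h2 : ‖T A'‖ ≤ ‖T (A' - B)‖ + ‖T B‖ := by
      simpa using norm_add_le (T (A' - B)) (T B)
    have h3 : ‖T (A' - B)‖ ≤ ‖T‖ * η := T.le_opNorm_of_le h1
    have h4 : η * (‖T‖ + 1) = ‖T A'‖ - δ := div_mul_cancel₀ _ hT1.ne'
    nlinarith

/-- If arbitrarily many positive contractions with orthogonal finite-dimensional ranges have large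
images, then so does their sum. -/
theorem exists_sum_of_orthogonal {T : SchattenClass p H →L[ℂ] SchattenClass q K}
    (hT : IsPositiveMap T) {δ : ℝ} (hδ : 0 < δ)
    (h : ∀ (V : Submodule ℂ H) (_ : FiniteDimensional ℂ V), ∃ B : SchattenClass p H,
      (toOperator B).IsPositive ∧ (∀ x ∈ V, toOperator B x = 0) ∧
      (∃ (W : Submodule ℂ H) (_ : FiniteDimensional ℂ W), ∀ x, toOperator B x ∈ W) ∧
      ‖B‖ ≤ 1 ∧ δ < ‖T B‖) (N : ℕ) :
    ∃ S : SchattenClass p H, (toOperator S).IsPositive ∧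
      (∃ (W : Submodule ℂ H) (_ : FiniteDimensional ℂ W), ∀ x, toOperator S x ∈ W) ∧
      ‖S‖ ^ p ≤ N ∧ N * δ ^ q ≤ ‖T S‖ ^ q := by
  have hp0 := exponent_pos p
  have hq0 := exponent_pos q
  induction N with
  | zero =>
    refine ⟨0, by simp, ⟨⊥, inferInstance, by simp⟩, ?_, ?_⟩
    · simp [Real.zero_rpow hp0.ne']
    · simp [Real.zero_rpow hq0.ne']
  | succ N ih =>
    obtain ⟨S, hS, ⟨W, hW, hSW⟩, hS1, hS2⟩ := ih
    -- The new `B` vanishes on a space containing the range of `S`, so `B S = 0` and `p`-th powers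
    -- of norms are subadditive; on the image side only McCarthy's inequality is available, and it
    -- suffices.
    obtain ⟨B, hB, hBW, ⟨W', hW', hBW'⟩, hB1, hB2⟩ := h W hW
    refine ⟨B + S, ?_, ⟨W' ⊔ W, inferInstance, fun x => ?_⟩, ?_, ?_⟩
    · rw [map_add]
      exact hB.add hS
    · rw [map_add, add_apply]
      exact Submodule.add_mem_sup (hBW' x) (hSW x)
    · have h1 := singularSum_add_le_of_mul_eq_zero hp.out B.isCompactOperator hB
        S.isCompactOperator hS fun x => hBW _ (hSW x)
      rw [← map_add, singularSum_toOperator, singularSum_toOperator, singularSum_toOperator,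
        ← ENNReal.ofReal_add (by positivity) (by positivity),
        ENNReal.ofReal_le_ofReal_iff (by positivity)] at h1
      have h2 : ‖B‖ ^ p ≤ 1 := Real.rpow_le_one (norm_nonneg B) hB1 hp0.le
      push_cast
      linarith
    · have h1 := singularSum_add_ge hq.out (T B).isCompactOperator (hT B hB)
        (T S).isCompactOperator (hT S hS)
      rw [← map_add, singularSum_toOperator, singularSum_toOperator, singularSum_toOperator,
        ← ENNReal.ofReal_add (by positivity) (by positivity),
        ENNReal.ofReal_le_ofReal_iff (by positivity)] at h1
      have h2 : δ ^ q ≤ ‖T B‖ ^ q := Real.rpow_le_rpow hδ.le hB2.le hq0.le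
      rw [map_add]
      push_cast
      linarith

/-- A positive operator `S_p(H) → S_q(K)` with `q < p` is small on the positive operators vanishing
on a suitable finite-dimensional subspace. -/
theorem exists_finiteDimensional_norm_le (hqp : q < p)
    {T : SchattenClass p H →L[ℂ] SchattenClass q K} (hT : IsPositiveMap T) {δ : ℝ} (hδ : 0 < δ) :
    ∃ (V : Submodule ℂ H) (_ : FiniteDimensional ℂ V), ∀ A : SchattenClass p H,
      (toOperator A).IsPositive → (∀ x ∈ V, toOperator A x = 0) → ‖T A‖ ≤ δ * ‖A‖ := by
  by_contra! hcon
  have hp0 := exponent_pos p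
  have hq0 := exponent_pos q
  have key := exists_sum_of_orthogonal hT hδ fun V hV => by
    obtain ⟨A, hA, hAV, hTA⟩ := hcon V hV
    obtain ⟨B, hB, hBker, hBr, hBn, hBT⟩ := exists_finiteRank_lt_norm T hA hTA
    exact ⟨B, hB, fun x hx => hBker x (hAV x hx), hBr, hBn, hBT⟩
  have hδq : 0 < δ ^ q := Real.rpow_pos_of_pos hδ q
  -- Rearranged from `N δ ^ q ≤ ‖T S‖ ^ q ≤ ‖T‖ ^ q N ^ (q / p)`; the exponent `1 - q / p` is
  -- positive exactly because `q < p`.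
  have hbound : ∀ N : ℕ, 0 < N → (N : ℝ) ^ (1 - q / p) ≤ ‖T‖ ^ q / δ ^ q := by
    intro N hN
    obtain ⟨S, -, -, hS1, hS2⟩ := key N
    have hN' : (0 : ℝ) < N := by exact_mod_cast hN
    have h1 : ‖T S‖ ^ q ≤ ‖T‖ ^ q * (N : ℝ) ^ (q / p) := by
      calc ‖T S‖ ^ q ≤ (‖T‖ * ‖S‖) ^ q :=
            Real.rpow_le_rpow (norm_nonneg _) (T.le_opNorm S) hq0.le
        _ = ‖T‖ ^ q * (‖S‖ ^ p) ^ (q / p) := by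
            rw [Real.mul_rpow (norm_nonneg _) (norm_nonneg _), ← Real.rpow_mul (norm_nonneg _),
              mul_div_cancel₀ _ hp0.ne']
        _ ≤ _ := by gcongr
    rw [Real.rpow_sub hN', Real.rpow_one, le_div_iff₀ hδq, div_mul_eq_mul_div,
      div_le_iff₀ (Real.rpow_pos_of_pos hN' _)]
    exact hS2.trans h1
  have hlim : Filter.Tendsto (fun N : ℕ => (N : ℝ) ^ (1 - q / p)) Filter.atTop Filter.atTop :=
    (tendsto_rpow_atTop (sub_pos.2 ((div_lt_one hp0).2 hqp))).comp tendsto_natCast_atTop_atTop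
  obtain ⟨N, hN, hN0⟩ := ((hlim.eventually_gt_atTop (‖T‖ ^ q / δ ^ q)).and
    (Filter.eventually_gt_atTop 0)).exists
  exact absurd (hbound N hN0) (not_le.2 hN)

/-! ### Approximation by compressions and compactness. -/

/-- Off-diagonal blocks of a positive operator are controlled by its diagonal blocks. -/
theorem norm_map_sub_compression_sub_compression_le
    {T : SchattenClass p H →L[ℂ] SchattenClass q K} (hT : IsPositiveMap T) {A : SchattenClass p H}
    (hA : (toOperator A).IsPositive) (V : Submodule ℂ H) [V.HasOrthogonalProjection] {a : ℝ}
    (ha : a ≠ 0) {A₁ A₂ : SchattenClass p H}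
    (h₁ : A₁ = compression p V.starProjection V.starProjection_norm_le A)
    (h₂ : A₂ = compression p Vᗮ.starProjection Vᗮ.starProjection_norm_le A) :
    ‖T (A - A₁ - A₂)‖ ≤ 2 * ‖T (((a ^ 2 : ℝ) : ℂ) • A₁ + (((a⁻¹) ^ 2 : ℝ) : ℂ) • A₂)‖ := by
  set Z := ((a ^ 2 : ℝ) : ℂ) • A₁ + (((a⁻¹) ^ 2 : ℝ) : ℂ) • A₂ with hZ
  set X := A - A₁ - A₂ with hX
  have hac : (a : ℂ) ≠ 0 := by exact_mod_cast ha
  -- For `b = a` and `b = -a` this conjugation of `A` equals `Z + X` and `Z - X`, where `X` is the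
  -- off-diagonal part.
  have hconj : ∀ b : ℝ, (((b : ℂ) • V.starProjection + ((a⁻¹ : ℝ) : ℂ) • Vᗮ.starProjection) ∘L
      toOperator A ∘L ((b : ℂ) • V.starProjection +
        ((a⁻¹ : ℝ) : ℂ) • Vᗮ.starProjection)).IsPositive := by
    intro b
    have hs : ContinuousLinearMap.adjoint
        ((b : ℂ) • V.starProjection + ((a⁻¹ : ℝ) : ℂ) • Vᗮ.starProjection) =
        (b : ℂ) • V.starProjection + ((a⁻¹ : ℝ) : ℂ) • Vᗮ.starProjection := by
      have e1 := (ContinuousLinearMap.isSelfAdjoint_iff'.1 (isSelfAdjoint_starProjection V))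
      have e2 := (ContinuousLinearMap.isSelfAdjoint_iff'.1 (isSelfAdjoint_starProjection Vᗮ))
      rw [map_add, map_smulₛₗ, map_smulₛₗ, e1, e2, Complex.conj_ofReal, Complex.conj_ofReal]
    have h := hA.conj_adjoint
      ((b : ℂ) • V.starProjection + ((a⁻¹ : ℝ) : ℂ) • Vᗮ.starProjection)
    rwa [hs] at h
  have hplus : (toOperator (Z + X)).IsPositive := by
    convert hconj a using 1
    ext x
    simp only [hZ, hX, h₁, h₂, map_add, map_sub, map_smul, toOperator_compression, add_apply,
      sub_apply, smul_apply, ContinuousLinearMap.comp_apply,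
      Submodule.starProjection_orthogonal_val, Complex.ofReal_inv, smul_sub,
      smul_add, smul_smul, mul_inv_cancel₀ hac, inv_mul_cancel₀ hac, sq]
    module
  have hminus : (toOperator (Z - X)).IsPositive := by
    convert hconj (-a) using 1
    ext x
    simp only [hZ, hX, h₁, h₂, map_add, map_sub, map_smul, toOperator_compression, add_apply,
      sub_apply, smul_apply, ContinuousLinearMap.comp_apply, Complex.ofReal_neg,
      Submodule.starProjection_orthogonal_val, Complex.ofReal_inv, smul_sub,
      smul_add, smul_smul, neg_mul, mul_neg, mul_inv_cancel₀ hac, inv_mul_cancel₀ hac, sq]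
    module
  have hsum : T (Z + X) + T (Z - X) = (2 : ℂ) • T Z := by
    rw [← map_add, ← map_smul, two_smul]
    congr 1
    abel
  have hTp := hT _ hplus
  have hTm := hT _ hminus
  have n2 : ‖(2 : ℂ) • T Z‖ = 2 * ‖T Z‖ := by rw [norm_smul]; norm_num
  -- `T (Z + X)` and `T (Z - X)` are positive with sum `2 T Z`, so each is dominated by it; their
  -- difference is `2 T X`.
  have np : ‖T (Z + X)‖ ≤ 2 * ‖T Z‖ := by
    rw [← n2, ← hsum]
    refine norm_le_norm_of_singularSum_le (singularSum_mono hq.out (T (Z + X)).isCompactOperator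
      hTp (T (Z + X) + T (Z - X)).isCompactOperator ?_)
    rwa [map_add, add_sub_cancel_left]
  have nm : ‖T (Z - X)‖ ≤ 2 * ‖T Z‖ := by
    rw [← n2, ← hsum]
    refine norm_le_norm_of_singularSum_le (singularSum_mono hq.out (T (Z - X)).isCompactOperator
      hTm (T (Z + X) + T (Z - X)).isCompactOperator ?_)
    rwa [map_add, add_sub_cancel_right]
  have hd : T (Z + X) - T (Z - X) = (2 : ℂ) • T X := by
    rw [← map_sub, ← map_smul, two_smul]
    congr 1
    abel
  have n3 : ‖(2 : ℂ) • T X‖ = 2 * ‖T X‖ := by rw [norm_smul]; norm_num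
  have := norm_sub_le (T (Z + X)) (T (Z - X))
  rw [hd, n3] at this
  linarith

/-- The fourth power balances the blocks: the weight `a²` on `A₁` and the weight `a⁻²` on `A₂`,
whose image is at most `a⁴ ‖A‖`, both contribute order `a²`. The total is `2 a² (‖T‖ + 1) + a⁴ ≤ a²
(2 ‖T‖ + 3)`, times `‖A‖`. -/
theorem norm_map_sub_compression_le {T : SchattenClass p H →L[ℂ] SchattenClass q K}
    (hT : IsPositiveMap T) {V : Submodule ℂ H} [V.HasOrthogonalProjection] {a : ℝ} (ha : 0 < a)
    (ha1 : a ≤ 1)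
    (hV : ∀ A : SchattenClass p H, (toOperator A).IsPositive → (∀ x ∈ V, toOperator A x = 0) →
      ‖T A‖ ≤ a ^ 4 * ‖A‖) {A : SchattenClass p H} (hA : (toOperator A).IsPositive) :
    ‖T (A - compression p V.starProjection V.starProjection_norm_le A)‖ ≤
      a ^ 2 * (2 * ‖T‖ + 3) * ‖A‖ := by
  set A₁ := compression p V.starProjection V.starProjection_norm_le A with h₁
  set A₂ := compression p Vᗮ.starProjection Vᗮ.starProjection_norm_le A with h₂
  have n1 : ‖A₁‖ ≤ ‖A‖ := norm_compression_le _ A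
  have n2 : ‖A₂‖ ≤ ‖A‖ := norm_compression_le _ A
  have hT1 : ‖T A₁‖ ≤ ‖T‖ * ‖A‖ := T.le_opNorm_of_le n1
  have hT2 : ‖T A₂‖ ≤ a ^ 4 * ‖A‖ := by
    refine (hV A₂ (isPositive_compression hA) fun x hx => ?_).trans (by gcongr)
    have hx0 : Vᗮ.starProjection x = 0 := by
      rw [Submodule.starProjection_orthogonal_val, Submodule.starProjection_eq_self_iff.2 hx,
        sub_self]
    rw [h₂, toOperator_compression, ContinuousLinearMap.comp_apply, ContinuousLinearMap.comp_apply,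
      hx0, map_zero, map_zero]
  have hX := norm_map_sub_compression_sub_compression_le hT hA V ha.ne' h₁ h₂
  have hZ : ‖T (((a ^ 2 : ℝ) : ℂ) • A₁ + (((a⁻¹) ^ 2 : ℝ) : ℂ) • A₂)‖ ≤
      a ^ 2 * (‖T‖ * ‖A‖) + a ^ 2 * ‖A‖ := by
    rw [map_add, map_smul, map_smul]
    refine (norm_add_le _ _).trans ?_
    rw [norm_smul, norm_smul, Complex.norm_real, Complex.norm_real,
      Real.norm_of_nonneg (by positivity), Real.norm_of_nonneg (by positivity)]
    have e : a ^ 2 * ‖A‖ = (a⁻¹) ^ 2 * (a ^ 4 * ‖A‖) := by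
      field_simp
    rw [e]
    gcongr
  have hs : ‖T (A - A₁)‖ ≤ ‖T (A - A₁ - A₂)‖ + ‖T A₂‖ := by
    simpa using norm_add_le (T (A - A₁ - A₂)) (T A₂)
  have h4 : a ^ 4 * ‖A‖ ≤ a ^ 2 * ‖A‖ :=
    mul_le_mul_of_nonneg_right (pow_le_pow_of_le_one ha.le ha1 (by norm_num)) (norm_nonneg A)
  nlinarith

/-- The compression has finite rank: `P A P` is determined by the endomorphism of `V` it induces, so
its range embeds in `V →ₗ[ℂ] V`. -/
theorem isCompactOperator_comp_compression {E : Type*} [NormedAddCommGroup E] [NormedSpace ℂ E]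
    (T : SchattenClass p H →L[ℂ] E) (V : Submodule ℂ H) [FiniteDimensional ℂ V] :
    IsCompactOperator (T ∘L compression p V.starProjection V.starProjection_norm_le) := by
  set Φ := compression p V.starProjection V.starProjection_norm_le with hΦ
  let R : Submodule ℂ (SchattenClass p H) := LinearMap.range Φ.toLinearMap
  let j : R →ₗ[ℂ] (V →ₗ[ℂ] V) :=
    { toFun := fun X => (V.orthogonalProjectionOnto.toLinearMap ∘ₗ (toOperator X.1).toLinearMap) ∘ₗ
        V.subtype
      map_add' := fun X Y => by ext x; simp
      map_smul' := fun c X => by ext x; simp }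
  have hj : Function.Injective j := by
    rw [← LinearMap.ker_eq_bot, LinearMap.ker_eq_bot']
    rintro ⟨_, A, rfl⟩ hX
    apply Subtype.ext
    apply toOperator_injective
    ext x
    have h1 : V.orthogonalProjectionOnto (V.starProjection (toOperator A
        (V.starProjection (V.starProjection x)))) = 0 :=
      LinearMap.congr_fun hX ⟨V.starProjection x, V.starProjection_apply_mem x⟩
    have h2 : V.starProjection (V.starProjection (toOperator A
        (V.starProjection (V.starProjection x)))) = 0 := congrArg Subtype.val h1
    rw [Submodule.starProjection_eq_self_iff.2 (V.starProjection_apply_mem _),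
      Submodule.starProjection_eq_self_iff.2 (V.starProjection_apply_mem x)] at h2
    simpa [hΦ] using h2
  have hR : FiniteDimensional ℂ R := FiniteDimensional.of_injective j hj
  have hRp : ProperSpace R := FiniteDimensional.proper ℂ R
  have hid : IsCompactOperator (ContinuousLinearMap.id ℂ R) :=
    ⟨Metric.closedBall 0 1, isCompact_closedBall 0 1, Metric.closedBall_mem_nhds 0 one_pos⟩
  let Φ' : SchattenClass p H →L[ℂ] R := Φ.codRestrict R fun A => ⟨A, rfl⟩
  exact (hid.comp_clm Φ').clm_comp (T ∘L R.subtypeL)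

/-- A positive operator `S_p(H) → S_q(K)` with `q < p` is compact. -/
theorem isCompactOperator_of_isPositiveMap (hqp : q < p)
    {T : SchattenClass p H →L[ℂ] SchattenClass q K} (hT : IsPositiveMap T) :
    IsCompactOperator T := by
  suffices h : T ∈ closure {S : SchattenClass p H →L[ℂ] SchattenClass q K | IsCompactOperator S} by
    rwa [isClosed_setOfPred_isCompactOperator.closure_eq] at h
  rw [Metric.mem_closure_iff]
  intro ε hε
  -- The factor `4` counts the positive parts of `A`; `a` is then chosen with `a² c ≤ ε / 2`.
  set c : ℝ := 4 * (2 * ‖T‖ + 3) with hc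
  have hc0 : 0 < c := by positivity
  set a : ℝ := min 1 (Real.sqrt (ε / (2 * c))) with ha
  have ha0 : 0 < a := lt_min one_pos (Real.sqrt_pos.2 (by positivity))
  have ha1 : a ≤ 1 := min_le_left _ _
  have ha2 : a ^ 2 * c ≤ ε / 2 := by
    have : a ^ 2 ≤ ε / (2 * c) := by
      rw [← Real.sq_sqrt (show 0 ≤ ε / (2 * c) by positivity)]
      exact pow_le_pow_left₀ ha0.le (min_le_right _ _) 2
    calc a ^ 2 * c ≤ ε / (2 * c) * c := by gcongr
      _ = ε / 2 := by field_simp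
  obtain ⟨V, hV, hVT⟩ := exists_finiteDimensional_norm_le hqp hT (pow_pos ha0 4)
  set Φ := compression p V.starProjection V.starProjection_norm_le with hΦ
  refine ⟨T ∘L Φ, isCompactOperator_comp_compression T V, ?_⟩
  rw [dist_eq_norm]
  refine lt_of_le_of_lt ?_ (half_lt_self hε)
  refine ContinuousLinearMap.opNorm_le_bound _ (by positivity) fun A => ?_
  obtain ⟨B, hB, hAB⟩ := exists_positive_decomposition A
  have hBi : ∀ i, ‖(T - T ∘L Φ) (B i)‖ ≤ a ^ 2 * (2 * ‖T‖ + 3) * ‖A‖ := by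
    intro i
    have h := norm_map_sub_compression_le hT ha0 ha1 hVT (hB i).1
    rw [map_sub] at h
    refine h.trans ?_
    have := (hB i).2
    gcongr
  set L := T - T ∘L Φ
  have hLA : L A = L (B 0) - L (B 1) + Complex.I • (L (B 2) - L (B 3)) := by
    conv_lhs => rw [hAB]
    simp only [map_add, map_sub, map_smul]
  have h1 : ‖L A‖ ≤ ‖L (B 0)‖ + ‖L (B 1)‖ + (‖L (B 2)‖ + ‖L (B 3)‖) := by
    rw [hLA]
    refine (norm_add_le _ _).trans (add_le_add (norm_sub_le _ _) ?_)
    rw [norm_smul, Complex.norm_I, one_mul]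
    exact norm_sub_le _ _
  have h2 : a ^ 2 * c * ‖A‖ ≤ ε / 2 * ‖A‖ := mul_le_mul_of_nonneg_right ha2 (norm_nonneg A)
  have := hBi 0
  have := hBi 1
  have := hBi 2
  have := hBi 3
  rw [hc] at h2
  linarith

end SchattenClass

end

theorem theorem4p9 (p q : ℝ) [Fact (1 ≤ p)] [Fact (1 ≤ q)] (hqp : q < p)
    {H : Type*} [NormedAddCommGroup H] [InnerProductSpace ℂ H] [CompleteSpace H]
    [TopologicalSpace.SeparableSpace H]
    {K : Type*} [NormedAddCommGroup K] [InnerProductSpace ℂ K] [CompleteSpace K]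
    [TopologicalSpace.SeparableSpace K]
    (T : SchattenClass p H →L[ℂ] SchattenClass q K) (hT : IsPositiveMap T) :
    IsCompactOperator T :=
  SchattenClass.isCompactOperator_of_isPositiveMap hqp hT
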